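/- Let $H:\mathbb{R}^2\times\mathbb{R}^2\times\mathbb{R}\to\mathbb{R}$, $(x,p,w)\mapsto H(x,p,w)$, be of class $C^1$ and such that $H(x,\cdot,w)$ is strictly convex for all $(x,w)$. Let $\Omega\subset\mathbb{R}^2$ be open and connected, and let $u:\Omega\to\mathbb{R}$ be a locally semiconcave (viscosity) solution of $H(x,Du(x),u(x))=0$ in $\Omega$; that is, every $x\in\Omega$ has a ball $B(x,r)\subset\Omega$ and a constant $C>0$ with $\lambda u(y)+(1-\lambda)u(z)-u(\lambda y+(1-\lambda)z)\le \frac C2\lambda(1-\lambda)|y-z|^2$ for all $y,z\in B(x,r)$, $\lambda\in[0,1]$, and $H(x,Du(x),u(x))=0$ at almost every $x\in\Omega$. Put $$D^+u(x)=\Big\{p\in\mathbb{R}^2:\ \limsup_{y\to x}\frac{u(y)-u(x)-\langle p,y-x\rangle}{|y-x|}\le 0\Big\},\qquad \Sigma(u)=\{x\in\Omega:\ D^+u(x)\text{ is not a singleton}\}.$$ Then for every $x\in\Omega$ there is a unique $p^{\#}(x)\in D^+u(x)$ with $H(x,p^{\#}(x),u(x))\le H(x,p,u(x))$ for all $p\in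 D^+u(x)$. Put $v^{\#}(x)=H_p(x,p^{\#}(x),u(x))$. For every $x_0\in\Sigma(u)$ there exist $t_0>0$ and a Lipschitz curve $\gamma:[0,t_0]\to\mathbb{R}^2$ with $\gamma(0)=x_0$ such that 1. for every $t\in[0,t_0)$ the right derivative $\dot\gamma^+(t)$ exists and equals $v^{\#}(\gamma(t))$; 2. $\lim_{s\to t^+}v^{\#}(\gamma(s))=v^{\#}(\gamma(t))$ for every $t\in[0,t_0)$; 3. $\gamma(t)\in\Sigma(u)$ for every $t\in[0,t_0]$. In particular $\gamma$ is a strict singular characteristic from $x_0$ (with right-continuous right derivative): there is a measurable $p:[0,t_0]\to\mathbb{R}^2$ with $p(t)\in D^+u(\gamma(t))$ for all $t\in[0,t_0]$ and $\dot\gamma(t)=H_p(\gamma(t),p(t),u(\gamma(t)))$ for almost every $t\in[0,t_0]$. -/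

import Mathlib

open Set Filter Topology MeasureTheory

namespace HJ

/-- `u` is semiconcave (with linear modulus) with constant `C` on the (convex) set `B`. -/
def SemiconcaveOnWith {n : ℕ} (C : ℝ) (u : EuclideanSpace ℝ (Fin n) → ℝ)
    (B : Set (EuclideanSpace ℝ (Fin n))) : Prop :=
  ∀ x ∈ B, ∀ y ∈ B, ∀ l ∈ Icc (0 : ℝ) 1,
    l * u x + (1 - l) * u y - u (l • x + (1 - l) • y) ≤ C / 2 * l * (1 - l) * ‖x - y‖ ^ 2

/-- `u` is locally semiconcave on `Ω`: every point of `Ω` is the centre of an open ball contained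
in `Ω` on which `u` is semiconcave. Functions on `Ω` are represented by functions on the whole
space whose values outside `Ω` are never used. -/
def LocallySemiconcaveOn {n : ℕ} (u : EuclideanSpace ℝ (Fin n) → ℝ)
    (Ω : Set (EuclideanSpace ℝ (Fin n))) : Prop :=
  ∀ x ∈ Ω, ∃ r : ℝ, 0 < r ∧ Metric.ball x r ⊆ Ω ∧
    ∃ C : ℝ, 0 < C ∧ SemiconcaveOnWith C u (Metric.ball x r)

/-- The superdifferential `D⁺u(x)`: all `p` with
`limsup_{y → x} (u y - u x - ⟨p, y - x⟩) / |y - x| ≤ 0`, the limsup being spelled out with `ε`.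
Only the values of `u` near `x` matter. -/
def superdiff {n : ℕ} (u : EuclideanSpace ℝ (Fin n) → ℝ) (x : EuclideanSpace ℝ (Fin n)) :
    Set (EuclideanSpace ℝ (Fin n)) :=
  {p | ∀ ε : ℝ, 0 < ε → ∀ᶠ y in 𝓝[≠] x, (u y - u x - inner ℝ p (y - x)) / ‖y - x‖ ≤ ε}

/-- The singular set `Σ(u)` of `u : Ω → ℝ`: points whose superdifferential is not a singleton. -/
def singularSet {n : ℕ} (Ω : Set (EuclideanSpace ℝ (Fin n)))
    (u : EuclideanSpace ℝ (Fin n) → ℝ) : Set (EuclideanSpace ℝ (Fin n)) :=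
  {x | x ∈ Ω ∧ ¬ ∃ p, superdiff u x = {p}}

/-- `u` is a (viscosity) solution of `H(x, Du, u) = 0` on `Ω`, for `H` convex in `p`:
it is locally semiconcave and satisfies the equation at almost every point of `Ω`. -/
structure IsSemiconcaveSolution {n : ℕ}
    (H : EuclideanSpace ℝ (Fin n) → EuclideanSpace ℝ (Fin n) → ℝ → ℝ)
    (Ω : Set (EuclideanSpace ℝ (Fin n))) (u : EuclideanSpace ℝ (Fin n) → ℝ) : Prop where
  semiconcave : LocallySemiconcaveOn u Ω
  solves_ae : ∀ᵐ x ∂(volume.restrict Ω), DifferentiableAt ℝ u x ∧ H x (gradient u x) (u x) = 0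

/-- The partial gradient `H_p(x, p, w)`. -/
noncomputable def gradP {n : ℕ}
    (H : EuclideanSpace ℝ (Fin n) → EuclideanSpace ℝ (Fin n) → ℝ → ℝ)
    (x p : EuclideanSpace ℝ (Fin n)) (w : ℝ) : EuclideanSpace ℝ (Fin n) :=
  gradient (fun q => H x q w) p

/-- `p` minimizes `H(x, ·, u(x))` over `D⁺u(x)`. -/
def IsMinimalSupergradient {n : ℕ}
    (H : EuclideanSpace ℝ (Fin n) → EuclideanSpace ℝ (Fin n) → ℝ → ℝ)
    (u : EuclideanSpace ℝ (Fin n) → ℝ) (x p : EuclideanSpace ℝ (Fin n)) : Prop :=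
  p ∈ superdiff u x ∧ ∀ q ∈ superdiff u x, H x p (u x) ≤ H x q (u x)

/-- `p^#(x)`, the minimizer of `H(x, ·, u(x))` over `D⁺u(x)` (meaningful where there is one). -/
noncomputable def pSharp {n : ℕ}
    (H : EuclideanSpace ℝ (Fin n) → EuclideanSpace ℝ (Fin n) → ℝ → ℝ)
    (u : EuclideanSpace ℝ (Fin n) → ℝ) (x : EuclideanSpace ℝ (Fin n)) :
    EuclideanSpace ℝ (Fin n) :=
  Classical.epsilon (IsMinimalSupergradient H u x)

/-- `v^#(x) = H_p(x, p^#(x), u(x))`. -/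
noncomputable def vSharp {n : ℕ}
    (H : EuclideanSpace ℝ (Fin n) → EuclideanSpace ℝ (Fin n) → ℝ → ℝ)
    (u : EuclideanSpace ℝ (Fin n) → ℝ) (x : EuclideanSpace ℝ (Fin n)) :
    EuclideanSpace ℝ (Fin n) :=
  gradP H x (pSharp H u x) (u x)

/-- `γ`, restricted to `[0, T]`, is a strict singular characteristic from `x₀`: a Lipschitz curve
of singular points starting at `x₀` for which there is a measurable selection
`p(t) ∈ D⁺u(γ(t))` with `γ'(t) = H_p(γ(t), p(t), u(γ(t)))` for almost every `t ∈ [0, T]`. -/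
def IsStrictSingularCharacteristic {n : ℕ}
    (H : EuclideanSpace ℝ (Fin n) → EuclideanSpace ℝ (Fin n) → ℝ → ℝ)
    (Ω : Set (EuclideanSpace ℝ (Fin n))) (u : EuclideanSpace ℝ (Fin n) → ℝ)
    (x₀ : EuclideanSpace ℝ (Fin n)) (T : ℝ) (γ : ℝ → EuclideanSpace ℝ (Fin n)) : Prop :=
  (∃ K : NNReal, LipschitzOnWith K γ (Icc 0 T)) ∧
  γ 0 = x₀ ∧
  (∀ t ∈ Icc 0 T, γ t ∈ singularSet Ω u) ∧
  ∃ p : ℝ → EuclideanSpace ℝ (Fin n), Measurable p ∧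
    (∀ t ∈ Icc 0 T, p t ∈ superdiff u (γ t)) ∧
    ∀ᵐ t ∂(volume.restrict (Icc 0 T)), HasDerivAt γ (gradP H (γ t) (p t) (u (γ t))) t

end HJ

/-! Write `E(x)` for the minimum of `H(x, ·, u(x))` over `D⁺u(x)`. Singular points are exactly those
where `E < 0`. Indeed limiting gradients lie in `D⁺u(x)` and have zero energy, and enough of them
exist to force `H ≤ 0` on all of `D⁺u(x)` by separation; strict convexity makes the midpoint of two
distinct supergradients strictly negative. It therefore suffices to build a curve along which `E`
grows at most linearly in time.

The curve is a limit of Euler polygons for the local sup-convolution `u_ε(z) = max_y (u(y) - |y -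
z|² / (2ε))`. Its maximizer `y` carries a genuine supergradient `p = (y - z) / ε` of `u`, which acts
as the gradient of `u_ε` at `z`. This gradient is `3/ε`-Lipschitz, while its one-sided
(semiconcavity) bound `4C` does not depend on `ε`. With velocity `H_p(y, p, u(y))` and a time step
small compared with `ε`, convexity of `H` and the one-sided bound make the energy `H(y, p, u(y))`
grow at most at a uniform rate (`energy_step_le`).

The selection of the minimal supergradient comes from a comparison with an arbitrary `q ∈ D⁺u(γ(t))`
(`energy_sub_mul_le`, `energy_le_add`). Convexity bounds `⟨p - q, H_p(y, p, u(y))⟩` below by an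
energy difference. Summed over the steps, the left side is at most the increment of `u - ⟨q, ·⟩`
along the curve up to vanishing errors, and this is `O((s - t)²)` because `q` is a supergradient.
Dividing by `s - t`, the energy at each later time `s` is at most `H(γ(t), q, u(γ(t))) + O(s - t)`.

Taking `q = p^#(γ(t))` gives the linear bound on `E`, hence persistence of singularity. It also
shows that the supergradients used just after time `t` have nearly minimal energy, so by uniqueness
of the minimizer they are close to `p^#(γ(t))`. This yields both the right derivative and the right
continuity. -/

namespace HJ

/-- Euclidean space of dimension `n`. -/
abbrev Euc (n : ℕ) := EuclideanSpace ℝ (Fin n)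

/-! ### Superdifferentials of semiconcave functions. -/

variable {n : ℕ} {u : Euc n → ℝ} {Ω : Set (Euc n)} {c x y p q : Euc n} {r C L : ℝ}

theorem mem_superdiff_of_le (h : ∀ᶠ y in 𝓝 x, u y ≤ u x + inner ℝ p (y - x) + C * ‖y - x‖ ^ 2) :
    p ∈ superdiff u x := by
  intro ε hε
  have h2 : ∀ᶠ y in 𝓝 x, C * ‖y - x‖ ≤ ε := by
    have : Tendsto (fun y : Euc n => C * ‖y - x‖) (𝓝 x) (𝓝 (C * ‖x - x‖)) := by
      apply Continuous.tendsto; fun_prop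
    rw [sub_self, norm_zero, mul_zero] at this
    exact (this.eventually (gt_mem_nhds hε)).mono fun y hy => hy.le
  have h3 : ∀ᶠ y in 𝓝[≠] x, y ≠ x := eventually_mem_nhdsWithin
  filter_upwards [mem_nhdsWithin_of_mem_nhds h, mem_nhdsWithin_of_mem_nhds h2, h3] with y h1 h2 h3
  have hp : 0 < ‖y - x‖ := norm_pos_iff.2 (sub_ne_zero.2 h3)
  rw [div_le_iff₀ hp]
  nlinarith

theorem le_add_of_mem_superdiff (hp : p ∈ superdiff u x) {ε : ℝ} (hε : 0 < ε) :
    ∀ᶠ y in 𝓝 x, u y ≤ u x + inner ℝ p (y - x) + ε * ‖y - x‖ := by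
  have := hp ε hε
  rw [eventually_nhdsWithin_iff] at this
  filter_upwards [this] with y hy
  rcases eq_or_ne y x with rfl | hne
  · simp
  · have hp : 0 < ‖y - x‖ := norm_pos_iff.2 (sub_ne_zero.2 hne)
    have := hy hne
    rw [div_le_iff₀ hp] at this
    linarith

theorem tendsto_add_smul (x v : Euc n) : Tendsto (fun l : ℝ => x + l • v) (𝓝[>] 0) (𝓝 x) := by
  have : Tendsto (fun l : ℝ => x + l • v) (𝓝 0) (𝓝 (x + (0 : ℝ) • v)) := by
    apply Continuous.tendsto; fun_prop
  rw [zero_smul, add_zero] at this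
  exact this.mono_left nhdsWithin_le_nhds

/-- Semiconcavity upgrades the infinitesimal inequality at `x` to one on all of `B`: apply the
definition of `p` at `x + l(y - x)`, compare with the chord from `x` to `y`, divide by `l` and let
`l → 0`. -/
theorem SemiconcaveOnWith.le_of_mem_superdiff {B : Set (Euc n)} (h : SemiconcaveOnWith C u B)
    (hx : x ∈ B) (hy : y ∈ B) (hp : p ∈ superdiff u x) :
    u y ≤ u x + inner ℝ p (y - x) + C / 2 * ‖y - x‖ ^ 2 := by
  suffices H : ∀ ε > 0, u y ≤ u x + inner ℝ p (y - x) + C / 2 * ‖y - x‖ ^ 2 + ε * ‖y - x‖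
      + ε * |C / 2 * ‖y - x‖ ^ 2| by
    have : Tendsto (fun ε : ℝ => u x + inner ℝ p (y - x) + C / 2 * ‖y - x‖ ^ 2 + ε * ‖y - x‖
        + ε * |C / 2 * ‖y - x‖ ^ 2|) (𝓝[>] 0)
        (𝓝 (u x + inner ℝ p (y - x) + C / 2 * ‖y - x‖ ^ 2 + 0 * ‖y - x‖
          + 0 * |C / 2 * ‖y - x‖ ^ 2|)) := by
      refine Tendsto.mono_left (Continuous.tendsto ?_ _) nhdsWithin_le_nhds
      fun_prop
    simp only [zero_mul, add_zero] at this
    exact ge_of_tendsto this (eventually_mem_nhdsWithin.mono H)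
  intro ε hε
  have h1 := (tendsto_add_smul x (y - x)).eventually (le_add_of_mem_superdiff hp hε)
  -- `l < ε` lets the remainder `l * (C / 2 * ‖y - x‖ ^ 2)`, left after division by `l`, be absorbed
  -- by the last `ε` term.
  have h2 : ∀ᶠ l : ℝ in 𝓝[>] 0, l ∈ Ioo 0 (min 1 ε) :=
    Ioo_mem_nhdsGT (lt_min one_pos hε)
  obtain ⟨l, hl1, hl0, hl2⟩ := (h1.and h2).exists
  have hl3 : l < 1 := hl2.trans_le (min_le_left _ _)
  have hl4 : l < ε := hl2.trans_le (min_le_right _ _)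
  have h3 := h y hy x hx l ⟨hl0.le, hl3.le⟩
  have e : l • y + (1 - l) • x = x + l • (y - x) := by module
  rw [e] at h3
  rw [add_sub_cancel_left, inner_smul_right, norm_smul, Real.norm_of_nonneg hl0.le] at hl1
  have h4 : l * u y ≤ l * (u x + inner ℝ p (y - x) + C / 2 * ‖y - x‖ ^ 2 + ε * ‖y - x‖
      - l * (C / 2 * ‖y - x‖ ^ 2)) := by
    nlinarith
  have h5 := le_of_mul_le_mul_left h4 hl0
  have h6 : - (l * (C / 2 * ‖y - x‖ ^ 2)) ≤ ε * |C / 2 * ‖y - x‖ ^ 2| := by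
    have := neg_abs_le (C / 2 * ‖y - x‖ ^ 2)
    have := abs_nonneg (C / 2 * ‖y - x‖ ^ 2)
    nlinarith
  linarith

theorem norm_sq_convex_comb (x y : Euc n) (l : ℝ) :
    ‖l • x + (1 - l) • y‖ ^ 2 = l * ‖x‖ ^ 2 + (1 - l) * ‖y‖ ^ 2 - l * (1 - l) * ‖x - y‖ ^ 2 := by
  rw [norm_add_sq_real, norm_sub_sq_real, norm_smul, norm_smul, mul_pow, mul_pow,
    Real.norm_eq_abs, Real.norm_eq_abs, sq_abs, sq_abs, real_inner_smul_left,
    real_inner_smul_right]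
  ring

theorem SemiconcaveOnWith.concaveOn {B : Set (Euc n)} (hB : Convex ℝ B)
    (h : SemiconcaveOnWith C u B) : ConcaveOn ℝ B (fun x => u x - C / 2 * ‖x‖ ^ 2) := by
  refine ⟨hB, fun x hx y hy a b ha hb hab => ?_⟩
  obtain rfl : b = 1 - a := by linarith
  have h1 := h x hx y hy a ⟨ha, by linarith⟩
  have h2 := norm_sq_convex_comb x y a
  simp only [smul_eq_mul, h2]
  nlinarith

theorem SemiconcaveOnWith.exists_lipschitzOnWith (hr : 0 < r)
    (h : SemiconcaveOnWith C u (Metric.ball c r)) :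
    ∃ r' : ℝ, 0 < r' ∧ r' ≤ r ∧ ∃ K : NNReal, LipschitzOnWith K u (Metric.ball c r') := by
  have h1 := (h.concaveOn (convex_ball c r)).locallyLipschitzOn Metric.isOpen_ball
  obtain ⟨K, t, ht, hK⟩ := h1 (Metric.mem_ball_self hr)
  rw [Metric.isOpen_ball.nhdsWithin_eq (Metric.mem_ball_self hr)] at ht
  have h2 : ContDiffAt ℝ 1 (fun x : Euc n => C / 2 * ‖x‖ ^ 2) c :=
    (contDiff_const.mul (contDiff_norm_sq ℝ)).contDiffAt
  obtain ⟨K', t', ht', hK'⟩ := h2.exists_lipschitzOnWith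
  obtain ⟨s, hs, hs'⟩ := Metric.mem_nhds_iff.1 (inter_mem ht ht')
  refine ⟨min s r, lt_min hs hr, min_le_right _ _, K + K', ?_⟩
  have h3 := (hK.mono (inter_subset_left)).add (hK'.mono (inter_subset_right (s := t)))
  simp only [sub_add_cancel] at h3
  exact h3.mono ((Metric.ball_subset_ball (min_le_left _ _)).trans hs')

theorem norm_le_of_mem_superdiff (hr : 0 < r) (hL0 : 0 ≤ L)
    (hL : ∀ y ∈ Metric.ball x r, u x - u y ≤ L * ‖y - x‖) (hp : p ∈ superdiff u x) : ‖p‖ ≤ L := by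
  refine le_of_forall_pos_le_add fun ε hε => ?_
  rcases eq_or_ne p 0 with rfl | hp0
  · rw [norm_zero]; positivity
  -- Moving in the direction `-p` makes `u` decrease at rate at least `‖p‖ - ε` per unit length.
  have h1 := (tendsto_add_smul x (-p)).eventually (le_add_of_mem_superdiff hp hε)
  have h2 := (tendsto_add_smul x (-p)).eventually (Metric.ball_mem_nhds x hr)
  obtain ⟨l, ⟨h1, h2⟩, h3⟩ := ((h1.and h2).and eventually_mem_nhdsWithin).exists
  have h3 : 0 < l := h3
  have h4 := hL _ h2
  rw [add_sub_cancel_left, norm_smul, Real.norm_of_nonneg h3.le, norm_neg] at h4 h1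
  rw [inner_smul_right, inner_neg_right, real_inner_self_eq_norm_sq] at h1
  have hp' : 0 < ‖p‖ := norm_pos_iff.2 hp0
  have : (l * ‖p‖) * ‖p‖ ≤ (l * ‖p‖) * (L + ε) := by nlinarith
  exact le_of_mul_le_mul_left this (by positivity)

theorem mem_superdiff_of_differentiableAt (h : DifferentiableAt ℝ u x) :
    gradient u x ∈ superdiff u x := by
  intro ε hε
  have h1 := (hasGradientAt_iff_isLittleO.1 h.hasGradientAt).def hε
  filter_upwards [mem_nhdsWithin_of_mem_nhds h1, eventually_mem_nhdsWithin] with y hy hne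
  have hp : 0 < ‖y - x‖ := norm_pos_iff.2 (sub_ne_zero.2 hne)
  rw [div_le_iff₀ hp]
  exact (le_abs_self _).trans hy

/-- `u` is semiconcave with constant `C` and Lipschitz with constant `L` on the ball `B(c, r)`. -/
structure SemiconcaveLipschitzOn (u : Euc n → ℝ) (c : Euc n) (r C L : ℝ) : Prop where
  r_pos : 0 < r
  C_pos : 0 < C
  L_nonneg : 0 ≤ L
  semiconcave : SemiconcaveOnWith C u (Metric.ball c r)
  lipschitz : ∀ x ∈ Metric.ball c r, ∀ y ∈ Metric.ball c r, |u x - u y| ≤ L * ‖x - y‖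

theorem LocallySemiconcaveOn.exists_semiconcaveLipschitzOn (h : LocallySemiconcaveOn u Ω)
    (hc : c ∈ Ω) : ∃ r C L : ℝ, Metric.ball c r ⊆ Ω ∧ SemiconcaveLipschitzOn u c r C L := by
  obtain ⟨r, hr, hrΩ, C, hC, hs⟩ := h c hc
  obtain ⟨r', hr', hrr, K, hK⟩ := hs.exists_lipschitzOnWith hr
  have hsub := Metric.ball_subset_ball (x := c) hrr
  refine ⟨r', C, K, hsub.trans hrΩ, hr', hC, K.2,
    fun x hx y hy => hs x (hsub hx) y (hsub hy), fun x hx y hy => ?_⟩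
  have := hK.dist_le_mul x hx y hy
  rwa [Real.dist_eq, dist_eq_norm] at this

namespace SemiconcaveLipschitzOn

/-- On the right, `x` and `p` enter only through closed inequalities, affine in `p`. Stability under
limits, convexity and monotonicity of `D⁺u` all follow from this form. -/
theorem mem_superdiff_iff (h : SemiconcaveLipschitzOn u c r C L) (hx : x ∈ Metric.ball c r) :
    p ∈ superdiff u x ↔
      ∀ y ∈ Metric.ball c r, u y ≤ u x + inner ℝ p (y - x) + C / 2 * ‖y - x‖ ^ 2 :=
  ⟨fun hp _ hy => h.semiconcave.le_of_mem_superdiff hx hy hp, fun H =>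
    mem_superdiff_of_le (Filter.mem_of_superset (Metric.isOpen_ball.mem_nhds hx) H)⟩

theorem norm_le (h : SemiconcaveLipschitzOn u c r C L) (hx : x ∈ Metric.ball c r)
    (hp : p ∈ superdiff u x) : ‖p‖ ≤ L := by
  obtain ⟨s, hs, hs'⟩ := Metric.mem_nhds_iff.1 (Metric.isOpen_ball.mem_nhds hx)
  refine norm_le_of_mem_superdiff hs h.L_nonneg (fun y hy => ?_) hp
  rw [norm_sub_rev]
  exact (le_abs_self _).trans (h.lipschitz x hx y (hs' hy))

theorem continuousOn (h : SemiconcaveLipschitzOn u c r C L) :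
    ContinuousOn u (Metric.ball c r) := by
  have : LipschitzOnWith ⟨L, h.L_nonneg⟩ u (Metric.ball c r) :=
    LipschitzOnWith.of_dist_le_mul fun x hx y hy => by
      rw [Real.dist_eq, dist_eq_norm]; exact h.lipschitz x hx y hy
  exact this.continuousOn

theorem continuousAt (h : SemiconcaveLipschitzOn u c r C L) (hx : x ∈ Metric.ball c r) :
    ContinuousAt u x :=
  h.continuousOn.continuousAt (Metric.isOpen_ball.mem_nhds hx)

theorem mem_superdiff_of_tendsto (h : SemiconcaveLipschitzOn u c r C L)
    (hx : x ∈ Metric.ball c r) {ι : Type*} {l : Filter ι} [l.NeBot] {X P : ι → Euc n}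
    (hX : Tendsto X l (𝓝 x)) (hP : Tendsto P l (𝓝 p))
    (hXP : ∀ᶠ i in l, P i ∈ superdiff u (X i)) : p ∈ superdiff u x := by
  rw [h.mem_superdiff_iff hx]
  intro y hy
  have hu : Tendsto (fun i => u (X i)) l (𝓝 (u x)) := (h.continuousAt hx).tendsto.comp hX
  have hd : Tendsto (fun i => y - X i) l (𝓝 (y - x)) := tendsto_const_nhds.sub hX
  have h1 : Tendsto (fun i => u (X i) + inner ℝ (P i) (y - X i) + C / 2 * ‖y - X i‖ ^ 2) l
      (𝓝 (u x + inner ℝ p (y - x) + C / 2 * ‖y - x‖ ^ 2)) :=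
    (hu.add (hP.inner hd)).add ((hd.norm.pow 2).const_mul _)
  refine ge_of_tendsto h1 ?_
  filter_upwards [hXP, hX.eventually (Metric.isOpen_ball.mem_nhds hx)] with i hi hi'
  exact (h.mem_superdiff_iff hi').1 hi y hy

theorem inner_sub_le (h : SemiconcaveLipschitzOn u c r C L) (hx : x ∈ Metric.ball c r)
    (hy : y ∈ Metric.ball c r) (hp : p ∈ superdiff u x) (hq : q ∈ superdiff u y) :
    inner ℝ (p - q) (x - y) ≤ C * ‖x - y‖ ^ 2 := by
  have h1 := (h.mem_superdiff_iff hx).1 hp y hy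
  have h2 := (h.mem_superdiff_iff hy).1 hq x hx
  rw [← neg_sub x y, norm_neg, inner_neg_right] at h1
  rw [inner_sub_left]
  linarith

theorem convex_superdiff (h : SemiconcaveLipschitzOn u c r C L) (hx : x ∈ Metric.ball c r) :
    Convex ℝ (superdiff u x) := by
  intro p hp q hq a b ha hb hab
  rw [h.mem_superdiff_iff hx] at *
  intro y hy
  have h1 := hp y hy
  have h2 := hq y hy
  rw [inner_add_left, real_inner_smul_left, real_inner_smul_left]
  obtain rfl : b = 1 - a := by linarith
  nlinarith

theorem isCompact_superdiff (h : SemiconcaveLipschitzOn u c r C L) (hx : x ∈ Metric.ball c r) :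
    IsCompact (superdiff u x) := by
  refine Metric.isCompact_of_isClosed_isBounded ?_ ?_
  · refine isClosed_of_closure_subset fun p hp => ?_
    rw [mem_closure_iff_seq_limit] at hp
    obtain ⟨P, hP, hlim⟩ := hp
    exact h.mem_superdiff_of_tendsto hx tendsto_const_nhds hlim (Eventually.of_forall hP)
  · exact (Metric.isBounded_closedBall (x := (0 : Euc n)) (r := L)).subset fun p hp => by
      simpa using h.norm_le hx hp

end SemiconcaveLipschitzOn

/-! ### Limiting gradients and the sign of `H` on the superdifferential. -/

/-- A bounded family converges along every ultrafilter. -/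
theorem exists_tendsto_of_norm_le {ι : Type*} (l : Ultrafilter ι) {X : ι → Euc n} {R : ℝ}
    (h : ∀ᶠ i in (l : Filter ι), ‖X i‖ ≤ R) : ∃ x, Tendsto X l (𝓝 x) := by
  have h1 : (l.map X : Filter (Euc n)) ≤ 𝓟 (Metric.closedBall 0 R) :=
    le_principal_iff.2 (h.mono fun i hi => by simpa using hi)
  obtain ⟨x, -, hx⟩ := (isCompact_closedBall (0 : Euc n) R).ultrafilter_le_nhds _ h1
  exact ⟨x, hx⟩

/-- Gradients at points approaching `x` in the direction `v` accumulate at a zero-energy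
supergradient. The one-sided monotonicity of `D⁺u`, divided by the distance scale, shows that it
minimizes `⟨·, v⟩` over `D⁺u(x)`. -/
theorem exists_limiting_gradient {H : Euc n → Euc n → ℝ → ℝ}
    (hH : Continuous fun z : Euc n × Euc n × ℝ => H z.1 z.2.1 z.2.2)
    (hu : IsSemiconcaveSolution H Ω u) (h : SemiconcaveLipschitzOn u c r C L)
    (hΩ : Metric.ball c r ⊆ Ω) (hx : x ∈ Metric.ball c r) (v : Euc n) :
    ∃ p ∈ superdiff u x, H x p (u x) = 0 ∧ ∀ q ∈ superdiff u x, inner ℝ (p - q) v ≤ 0 := by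
  have hae : ∀ᵐ y, y ∈ Metric.ball c r →
      DifferentiableAt ℝ u y ∧ H y (gradient u y) (u y) = 0 :=
    (ae_restrict_iff' Metric.isOpen_ball.measurableSet).1
      (ae_restrict_of_ae_restrict_of_subset hΩ hu.solves_ae)
  have hdense := Measure.dense_of_ae hae
  -- The error is quadratic in the step `1 / (k + 1)`, so the rescaled differences still converge to
  -- `v`.
  have hex : ∀ k : ℕ, ∃ y, ‖y - (x + (1 / (k + 1 : ℝ)) • v)‖ < (1 / (k + 1 : ℝ)) ^ 2 ∧
      (y ∈ Metric.ball c r → DifferentiableAt ℝ u y ∧ H y (gradient u y) (u y) = 0) := by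
    intro k
    obtain ⟨y, hy, hy'⟩ := hdense.exists_dist_lt (x + (1 / (k + 1 : ℝ)) • v)
      (ε := (1 / (k + 1 : ℝ)) ^ 2) (by positivity)
    exact ⟨y, by rwa [dist_comm, dist_eq_norm] at hy', hy⟩
  choose Y hY hY' using hex
  have ht : Tendsto (fun k : ℕ => 1 / (k + 1 : ℝ)) (hyperfilter ℕ) (𝓝 0) :=
    tendsto_one_div_add_atTop_nhds_zero_nat.mono_left Nat.hyperfilter_le_atTop
  have hdir : Tendsto (fun k : ℕ => ((1 / (k + 1 : ℝ))⁻¹) • (Y k - x)) (hyperfilter ℕ) (𝓝 v) := by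
    rw [tendsto_iff_norm_sub_tendsto_zero]
    refine squeeze_zero (fun _ => norm_nonneg _) (fun k => ?_) ht
    have hk : 0 < 1 / (k + 1 : ℝ) := by positivity
    set t := 1 / (k + 1 : ℝ)
    have e : t⁻¹ • (Y k - x) - v = t⁻¹ • (Y k - (x + t • v)) := by
      rw [← sub_sub, smul_sub t⁻¹ (Y k - x), inv_smul_smul₀ hk.ne']
    rw [e, norm_smul, norm_inv, Real.norm_of_nonneg hk.le, inv_mul_le_iff₀ hk, ← sq]
    exact (hY k).le
  have hYd : Tendsto (fun k => Y k - x) (hyperfilter ℕ) (𝓝 0) := by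
    have := ht.smul hdir
    rw [zero_smul] at this
    refine this.congr fun k => ?_
    rw [smul_inv_smul₀]; positivity
  have hYx : Tendsto Y (hyperfilter ℕ) (𝓝 x) := by
    simpa using hYd.add_const x
  have hball := hYx.eventually (Metric.isOpen_ball.mem_nhds hx)
  have hgrad : ∀ᶠ k in (hyperfilter ℕ : Filter ℕ), gradient u (Y k) ∈ superdiff u (Y k) :=
    hball.mono fun k hk => mem_superdiff_of_differentiableAt (hY' k hk).1
  obtain ⟨p, hp⟩ := exists_tendsto_of_norm_le (hyperfilter ℕ) (X := fun k => gradient u (Y k))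
    (R := L) ((hball.and hgrad).mono fun k hk => h.norm_le hk.1 hk.2)
  have hpx := h.mem_superdiff_of_tendsto hx hYx hp hgrad
  refine ⟨p, hpx, ?_, fun q hq => ?_⟩
  · have h1 : Tendsto (fun k => H (Y k) (gradient u (Y k)) (u (Y k))) (hyperfilter ℕ)
        (𝓝 (H x p (u x))) :=
      (hH.tendsto (x, p, u x)).comp
        (hYx.prodMk_nhds (hp.prodMk_nhds ((h.continuousAt hx).tendsto.comp hYx)))
    have h2 : Tendsto (fun k => H (Y k) (gradient u (Y k)) (u (Y k))) (hyperfilter ℕ) (𝓝 0) :=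
      tendsto_const_nhds.congr' (hball.mono fun k hk => (hY' k hk).2.symm)
    exact tendsto_nhds_unique h1 h2
  · have h1 : Tendsto (fun k : ℕ => inner ℝ (gradient u (Y k) - q)
        (((1 / (k + 1 : ℝ))⁻¹) • (Y k - x))) (hyperfilter ℕ) (𝓝 (inner ℝ (p - q) v)) :=
      (hp.sub_const q).inner hdir
    have h2 : Tendsto (fun k : ℕ => C * (‖((1 / (k + 1 : ℝ))⁻¹) • (Y k - x)‖ * ‖Y k - x‖))
        (hyperfilter ℕ) (𝓝 (C * (‖v‖ * ‖(0 : Euc n)‖))) :=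
      (hdir.norm.mul hYd.norm).const_mul C
    rw [norm_zero, mul_zero, mul_zero] at h2
    refine le_of_tendsto_of_tendsto h1 h2 ?_
    filter_upwards [hball, hgrad] with k hk hk'
    have h3 := h.inner_sub_le hk hx hk' hq
    have hk0 : 0 < (1 / (k + 1 : ℝ))⁻¹ := by positivity
    rw [inner_smul_right, norm_smul, Real.norm_of_nonneg hk0.le]
    nlinarith

/-- The equation holds as an inequality on the whole superdifferential. -/
theorem hamiltonian_nonpos {H : Euc n → Euc n → ℝ → ℝ}
    (hH : Continuous fun z : Euc n × Euc n × ℝ => H z.1 z.2.1 z.2.2)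
    (hconv : ∀ x w, ConvexOn ℝ univ fun p => H x p w)
    (hu : IsSemiconcaveSolution H Ω u) (h : SemiconcaveLipschitzOn u c r C L)
    (hΩ : Metric.ball c r ⊆ Ω) (hx : x ∈ Metric.ball c r) (hp : p ∈ superdiff u x) :
    H x p (u x) ≤ 0 := by
  by_contra hcon
  have hcx : Convex ℝ {q | H x q (u x) ≤ 0} := by
    simpa using (hconv x (u x)).convex_le 0
  have hcl : IsClosed {q | H x q (u x) ≤ 0} :=
    isClosed_le (hH.comp (by fun_prop : Continuous fun q : Euc n => (x, q, u x))) continuous_const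
  -- The separating functional is strictly smaller at `p` than on the sublevel set. The limiting
  -- gradient in its direction lies in that set, yet minimizes the functional over `D⁺u(x)`.
  obtain ⟨f, s, hf1, hf2⟩ := geometric_hahn_banach_point_closed hcx hcl hcon
  obtain ⟨q, hq, hq0, hq1⟩ := exists_limiting_gradient hH hu h hΩ hx
    ((InnerProductSpace.toDual ℝ (Euc n)).symm f)
  have h1 := hq1 p hp
  rw [real_inner_comm, InnerProductSpace.toDual_symm_apply, map_sub] at h1
  have h2 := hf2 q hq0.le
  linarith

end HJ

/-! ### The minimal supergradient and the energy criterion for singular points. -/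

namespace HJ

variable {n : ℕ} {u : Euc n → ℝ} {Ω : Set (Euc n)} {c x y p q : Euc n} {r C L w : ℝ}
  {H : Euc n → Euc n → ℝ → ℝ}

theorem hasGradientAt_gradP
    (hH : ContDiff ℝ 1 fun z : Euc n × Euc n × ℝ => H z.1 z.2.1 z.2.2) (x p : Euc n) (w : ℝ) :
    HasGradientAt (fun q => H x q w) (gradP H x p w) p := by
  have h1 : DifferentiableAt ℝ (fun q => H x q w) p :=
    ((hH.differentiable one_ne_zero).comp
      (by fun_prop : Differentiable ℝ fun q : Euc n => (x, q, w))) p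
  exact h1.hasGradientAt

theorem continuous_gradP
    (hH : ContDiff ℝ 1 fun z : Euc n × Euc n × ℝ => H z.1 z.2.1 z.2.2) :
    Continuous fun z : Euc n × Euc n × ℝ => gradP H z.1 z.2.1 z.2.2 := by
  set F := fun z : Euc n × Euc n × ℝ => H z.1 z.2.1 z.2.2
  let j : Euc n →L[ℝ] Euc n × Euc n × ℝ :=
    (ContinuousLinearMap.inr ℝ (Euc n) (Euc n × ℝ)).comp (ContinuousLinearMap.inl ℝ (Euc n) ℝ)
  have h1 : ∀ z : Euc n × Euc n × ℝ, gradP H z.1 z.2.1 z.2.2 =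
      (InnerProductSpace.toDual ℝ (Euc n)).symm ((fderiv ℝ F z).comp j) := by
    intro z
    have hj : HasFDerivAt (fun q : Euc n => (z.1, q, z.2.2)) j z.2.1 := by
      have e : (fun q : Euc n => (z.1, q, z.2.2)) = fun q => j q + (z.1, 0, z.2.2) := by
        funext q; simp [j]
      rw [e]
      exact j.hasFDerivAt.add_const _
    have hF : HasFDerivAt F (fderiv ℝ F z) (z.1, z.2.1, z.2.2) :=
      (hH.differentiable one_ne_zero z).hasFDerivAt
    have := (HasFDerivAt.comp z.2.1 hF hj).hasGradientAt
    exact this.gradient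
  have h2 : Continuous fun z => (InnerProductSpace.toDual ℝ (Euc n)).symm ((fderiv ℝ F z).comp j) :=
    (LinearIsometryEquiv.continuous _).comp
      ((hH.continuous_fderiv one_ne_zero).clm_comp continuous_const)
  exact h2.congr fun z => (h1 z).symm

theorem add_inner_gradP_le
    (hH : ContDiff ℝ 1 fun z : Euc n × Euc n × ℝ => H z.1 z.2.1 z.2.2)
    (hconv : ConvexOn ℝ univ fun p => H x p w) (p q : Euc n) :
    H x p w + inner ℝ (gradP H x p w) (q - p) ≤ H x q w := by
  have hl : HasDerivAt (fun t : ℝ => p + t • (q - p)) (q - p) 0 := by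
    simpa using ((hasDerivAt_id (0 : ℝ)).smul_const (q - p)).const_add p
  have h0 := (hasGradientAt_gradP hH x p w).hasFDerivAt
  have h1 : HasDerivAt (fun t : ℝ => H x (p + t • (q - p)) w)
      (inner ℝ (gradP H x p w) (q - p)) 0 := by
    have e : p = p + (0 : ℝ) • (q - p) := by simp
    rw [e] at h0
    have h2 := h0.comp_hasDerivAt (0 : ℝ) hl
    rw [zero_smul, add_zero] at h2
    exact h2
  have h2 : ConvexOn ℝ univ fun t : ℝ => H x (p + t • (q - p)) w := by
    have := hconv.comp_affineMap (AffineMap.lineMap p q : ℝ →ᵃ[ℝ] Euc n)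
    rw [preimage_univ] at this
    refine this.congr fun t _ => ?_
    simp [AffineMap.lineMap_apply, add_comm]
  have h3 := h2.le_slope_of_hasDerivAt (mem_univ 0) (mem_univ 1) one_pos h1
  simp [slope_def_field] at h3
  linarith

namespace SemiconcaveLipschitzOn

theorem existsUnique_isMinimalSupergradient
    (hH : Continuous fun z : Euc n × Euc n × ℝ => H z.1 z.2.1 z.2.2)
    (hconv : ∀ x w, StrictConvexOn ℝ univ fun p => H x p w)
    (hu : IsSemiconcaveSolution H Ω u) (h : SemiconcaveLipschitzOn u c r C L)
    (hΩ : Metric.ball c r ⊆ Ω) (hx : x ∈ Metric.ball c r) :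
    ∃! p, IsMinimalSupergradient H u x p := by
  obtain ⟨p₀, hp₀, -⟩ := exists_limiting_gradient hH hu h hΩ hx 0
  have hc : Continuous fun q => H x q (u x) :=
    hH.comp (by fun_prop : Continuous fun q : Euc n => (x, q, u x))
  obtain ⟨p, hp, hmin⟩ := (h.isCompact_superdiff hx).exists_isMinOn ⟨p₀, hp₀⟩ hc.continuousOn
  refine ⟨p, ⟨hp, fun q hq => hmin hq⟩, fun q hq => ?_⟩
  by_contra hne
  have h1 := (hconv x (u x)).2 (mem_univ q) (mem_univ p) hne (half_pos one_pos)
    (half_pos one_pos) (add_halves (1 : ℝ))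
  have h2 := hq.2 _ (h.convex_superdiff hx hq.1 hp (a := 1 / 2) (b := 1 / 2)
    (by norm_num) (by norm_num) (by norm_num))
  have h3 := hq.2 p hp
  have h4 : H x p (u x) ≤ H x q (u x) := hmin hq.1
  simp only [smul_eq_mul] at h1
  linarith

theorem isMinimalSupergradient_pSharp
    (hH : Continuous fun z : Euc n × Euc n × ℝ => H z.1 z.2.1 z.2.2)
    (hconv : ∀ x w, StrictConvexOn ℝ univ fun p => H x p w)
    (hu : IsSemiconcaveSolution H Ω u) (h : SemiconcaveLipschitzOn u c r C L)
    (hΩ : Metric.ball c r ⊆ Ω) (hx : x ∈ Metric.ball c r) :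
    IsMinimalSupergradient H u x (pSharp H u x) :=
  Classical.epsilon_spec (h.existsUnique_isMinimalSupergradient hH hconv hu hΩ hx).exists

/-- If the minimal energy were nonnegative, a second supergradient would give a midpoint of negative
energy, as `H ≤ 0` on `D⁺u(x)`. Conversely a one-point superdifferential consists of a limiting
gradient, whose energy is zero. -/
theorem mem_singularSet_iff
    (hH : Continuous fun z : Euc n × Euc n × ℝ => H z.1 z.2.1 z.2.2)
    (hconv : ∀ x w, StrictConvexOn ℝ univ fun p => H x p w)
    (hu : IsSemiconcaveSolution H Ω u) (h : SemiconcaveLipschitzOn u c r C L)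
    (hΩ : Metric.ball c r ⊆ Ω) (hx : x ∈ Metric.ball c r) :
    x ∈ singularSet Ω u ↔ H x (pSharp H u x) (u x) < 0 := by
  have hp := h.isMinimalSupergradient_pSharp hH hconv hu hΩ hx
  set p := pSharp H u x
  constructor
  · intro hs
    by_contra hcon
    refine hs.2 ⟨p, Subset.antisymm (fun q hq => ?_) (singleton_subset_iff.2 hp.1)⟩
    by_contra hne
    have h1 := (hconv x (u x)).2 (mem_univ q) (mem_univ p) hne (half_pos one_pos)
      (half_pos one_pos) (add_halves (1 : ℝ))
    have h2 := hp.2 _ (h.convex_superdiff hx hq hp.1 (a := 1 / 2) (b := 1 / 2)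
      (by norm_num) (by norm_num) (by norm_num))
    have hnp := fun q => hamiltonian_nonpos (p := q) hH (fun x w => (hconv x w).convexOn) hu h hΩ hx
    have h3 := hnp q hq
    have h4 := hnp p hp.1
    simp only [smul_eq_mul] at h1
    linarith
  · rintro hneg
    refine ⟨hΩ hx, ?_⟩
    rintro ⟨q, hq⟩
    obtain ⟨q', hq', h0, -⟩ := exists_limiting_gradient hH hu h hΩ hx 0
    have hp' := hp.1
    rw [hq, mem_singleton_iff] at hq' hp'
    rw [hp', ← hq', h0] at hneg
    exact lt_irrefl _ hneg

/-- Supergradients at nearby points with almost minimal energy are close to the minimal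
supergradient. -/
theorem exists_forall_dist_pSharp_lt
    (hH : Continuous fun z : Euc n × Euc n × ℝ => H z.1 z.2.1 z.2.2)
    (hconv : ∀ x w, StrictConvexOn ℝ univ fun p => H x p w)
    (hu : IsSemiconcaveSolution H Ω u) (h : SemiconcaveLipschitzOn u c r C L)
    (hΩ : Metric.ball c r ⊆ Ω) (hx : x ∈ Metric.ball c r) {ε : ℝ} (hε : 0 < ε) :
    ∃ δ > 0, ∀ y p, ‖y - x‖ < δ → p ∈ superdiff u y →
      H y p (u y) < H x (pSharp H u x) (u x) + δ → ‖p - pSharp H u x‖ < ε := by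
  -- Compactness: counterexamples with `δ = 1 / (k + 1)` have a limit supergradient of minimal
  -- energy, which must be `p^#(x)`.
  by_contra! hcon
  have hk : ∀ k : ℕ, (0 : ℝ) < 1 / (k + 1) := fun k => by positivity
  choose Y P hY hP hE hε' using fun k : ℕ => hcon _ (hk k)
  have ht : Tendsto (fun k : ℕ => 1 / (k + 1 : ℝ)) (hyperfilter ℕ) (𝓝 0) :=
    tendsto_one_div_add_atTop_nhds_zero_nat.mono_left Nat.hyperfilter_le_atTop
  have hYx : Tendsto Y (hyperfilter ℕ) (𝓝 x) := by
    rw [tendsto_iff_norm_sub_tendsto_zero]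
    exact squeeze_zero (fun _ => norm_nonneg _) (fun k => (hY k).le) ht
  obtain ⟨p, hp⟩ := exists_tendsto_of_norm_le (hyperfilter ℕ) (X := P) (R := L)
    ((hYx.eventually (Metric.isOpen_ball.mem_nhds hx)).mono fun k hk => h.norm_le hk (hP k))
  have hpx := h.mem_superdiff_of_tendsto hx hYx hp (Eventually.of_forall hP)
  have h1 : Tendsto (fun k => H (Y k) (P k) (u (Y k))) (hyperfilter ℕ) (𝓝 (H x p (u x))) :=
    (hH.tendsto (x, p, u x)).comp
      (hYx.prodMk_nhds (hp.prodMk_nhds ((h.continuousAt hx).tendsto.comp hYx)))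
  have h2 : H x p (u x) ≤ H x (pSharp H u x) (u x) + 0 :=
    le_of_tendsto_of_tendsto h1 (ht.const_add _) (Eventually.of_forall fun k => (hE k).le)
  have hmin := h.isMinimalSupergradient_pSharp hH hconv hu hΩ hx
  have hmin' : IsMinimalSupergradient H u x p :=
    ⟨hpx, fun q hq => by have := hmin.2 q hq; linarith⟩
  have he := (h.existsUnique_isMinimalSupergradient hH hconv hu hΩ hx).unique hmin' hmin
  have h3 : Tendsto (fun k => ‖P k - pSharp H u x‖) (hyperfilter ℕ) (𝓝 ‖p - pSharp H u x‖) :=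
    (hp.sub_const _).norm
  have h4 := ge_of_tendsto h3 (Eventually.of_forall hε')
  rw [he, sub_self, norm_zero] at h4
  linarith

end SemiconcaveLipschitzOn

end HJ

/-! ### Sup-convolution of a semiconcave function. -/

namespace HJ

variable {n : ℕ} {u : Euc n → ℝ} {Ω : Set (Euc n)} {c x y z p q y' z' p' : Euc n}
  {r C L w ε : ℝ} {H : Euc n → Euc n → ℝ → ℝ}

/-- `y` maximizes `u - |· - z|² / (2ε)` over the ball `B(c, r / 2)`, and `p = (y - z) / ε` is the
corresponding supergradient. -/
structure IsProximal (u : Euc n → ℝ) (c : Euc n) (r ε : ℝ) (z y p : Euc n) : Prop where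
  mem_ball : y ∈ Metric.ball c (r / 2)
  mem_superdiff : p ∈ superdiff u y
  eq_add : y = z + ε • p
  le : ∀ y' ∈ Metric.ball c (r / 2), u y' - ‖y' - z‖ ^ 2 / (2 * ε) ≤ u y - ε / 2 * ‖p‖ ^ 2

namespace SemiconcaveLipschitzOn

/-- Comparison with the competitor `y = z` gives `‖y - z‖ ≤ 2εL < r / 4`. The maximum over the
closed ball is thus attained in its interior, which makes the quadratic test function yield a
supergradient. -/
theorem exists_isProximal (h : SemiconcaveLipschitzOn u c r C L) (hε : 0 < ε)
    (hεL : 2 * ε * L < r / 4) (hz : ‖z - c‖ ≤ r / 4) : ∃ y p, IsProximal u c r ε z y p := by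
  have hr := h.r_pos
  have hsub : Metric.closedBall c (r / 2) ⊆ Metric.ball c r :=
    Metric.closedBall_subset_ball (by linarith)
  have hcont : ContinuousOn (fun y => u y - ‖y - z‖ ^ 2 / (2 * ε)) (Metric.closedBall c (r / 2)) :=
    (h.continuousOn.mono hsub).sub (by fun_prop)
  have hzK : z ∈ Metric.closedBall c (r / 2) := by
    rw [mem_closedBall_iff_norm]; linarith
  obtain ⟨y, hy, hmax⟩ := (isCompact_closedBall c (r / 2)).exists_isMaxOn ⟨z, hzK⟩ hcont
  have hmax' : ∀ y' ∈ Metric.closedBall c (r / 2),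
      u y' - ‖y' - z‖ ^ 2 / (2 * ε) ≤ u y - ‖y - z‖ ^ 2 / (2 * ε) := fun y' hy' => hmax hy'
  have hyz : ‖y - z‖ ≤ 2 * ε * L := by
    have h1 := hmax' z hzK
    rw [sub_self, norm_zero, zero_pow two_ne_zero, zero_div, sub_zero] at h1
    have h2 := (le_abs_self _).trans (h.lipschitz y (hsub hy) z (hsub hzK))
    have h3 : ‖y - z‖ ^ 2 / (2 * ε) ≤ L * ‖y - z‖ := by linarith
    rw [div_le_iff₀ (by positivity)] at h3
    rcases (norm_nonneg (y - z)).eq_or_lt with h0 | h0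
    · rw [← h0]; have := h.L_nonneg; positivity
    · exact le_of_mul_le_mul_right (by linarith) h0
  have hyb : y ∈ Metric.ball c (r / 2) := by
    rw [mem_ball_iff_norm]
    have : ‖y - c‖ ≤ ‖y - z‖ + ‖z - c‖ := norm_sub_le_norm_sub_add_norm_sub _ _ _
    linarith
  have e : ε • (1 / ε) • (y - z) = y - z := by
    rw [smul_smul, mul_one_div_cancel hε.ne', one_smul]
  have e1 : y = z + ε • (1 / ε) • (y - z) := by rw [e]; abel
  refine ⟨y, (1 / ε) • (y - z), hyb, ?_, e1, fun y' hy' => ?_⟩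
  · refine mem_superdiff_of_le (C := 1 / (2 * ε)) ?_
    filter_upwards [Metric.isOpen_ball.mem_nhds hyb] with y' hy'
    have h1 := hmax' y' (Metric.ball_subset_closedBall hy')
    have h2 : ‖y' - z‖ ^ 2 = ‖y' - y‖ ^ 2 + 2 * inner ℝ (y - z) (y' - y) + ‖y - z‖ ^ 2 := by
      rw [← sub_add_sub_cancel y' y z, norm_add_sq_real, real_inner_comm]
    rw [real_inner_smul_left]
    rw [h2] at h1
    have h3 : (‖y' - y‖ ^ 2 + 2 * inner ℝ (y - z) (y' - y) + ‖y - z‖ ^ 2) / (2 * ε) =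
        1 / (2 * ε) * ‖y' - y‖ ^ 2 + 1 / ε * inner ℝ (y - z) (y' - y) + ‖y - z‖ ^ 2 / (2 * ε) := by
      field_simp
    linarith
  · have h1 := hmax' y' (Metric.ball_subset_closedBall hy')
    have h2 : ε / 2 * ‖(1 / ε) • (y - z)‖ ^ 2 = ‖y - z‖ ^ 2 / (2 * ε) := by
      rw [norm_smul, Real.norm_of_nonneg (by positivity)]
      field_simp
    rwa [h2]

/-- All three bounds come from `y - y' = (z - z') + ε(p - p')` and the one-sided bound on `⟨p - p',
y - y'⟩`; the condition `εC ≤ 1 / 2` absorbs the semiconcavity term. The last constant is free of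
`ε`, which is what survives in the limit. -/
theorem isProximal_estimates (h : SemiconcaveLipschitzOn u c r C L) (hε : 0 < ε)
    (hεC : ε * C ≤ 1 / 2) (hz : IsProximal u c r ε z y p) (hz' : IsProximal u c r ε z' y' p') :
    ‖y - y'‖ ≤ 2 * ‖z - z'‖ ∧ ε * ‖p - p'‖ ≤ 3 * ‖z - z'‖ ∧
      inner ℝ (p - p') (z - z') ≤ 4 * C * ‖z - z'‖ ^ 2 := by
  have hsub : Metric.ball c (r / 2) ⊆ Metric.ball c r :=
    Metric.ball_subset_ball (by linarith [h.r_pos])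
  have hm := h.inner_sub_le (hsub hz.mem_ball) (hsub hz'.mem_ball) hz.mem_superdiff
    hz'.mem_superdiff
  have hy : y - y' = (z - z') + ε • (p - p') := by rw [hz.eq_add, hz'.eq_add]; module
  have hC := h.C_pos
  have h1 : ‖y - y'‖ ≤ 2 * ‖z - z'‖ := by
    have h2 : ‖y - y'‖ ^ 2 = inner ℝ (z - z') (y - y') + ε * inner ℝ (p - p') (y - y') := by
      rw [← real_inner_self_eq_norm_sq, ← real_inner_smul_left, ← inner_add_left, ← hy]
    have h3 := real_inner_le_norm (z - z') (y - y')
    have h4 : ε * inner ℝ (p - p') (y - y') ≤ 1 / 2 * ‖y - y'‖ ^ 2 := by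
      calc _ ≤ ε * (C * ‖y - y'‖ ^ 2) := by gcongr
        _ = (ε * C) * ‖y - y'‖ ^ 2 := by ring
        _ ≤ _ := by gcongr
    rcases (norm_nonneg (y - y')).eq_or_lt with h0 | h0
    · rw [← h0]; positivity
    · exact le_of_mul_le_mul_right (by nlinarith) h0
  refine ⟨h1, ?_, ?_⟩
  · have h2 : ε • (p - p') = (y - y') - (z - z') := by rw [hy]; abel
    have h3 := norm_sub_le (y - y') (z - z')
    rw [← h2, norm_smul, Real.norm_of_nonneg hε.le] at h3
    linarith
  · have h2 : z - z' = (y - y') - ε • (p - p') := by rw [hy]; abel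
    have h3 : inner ℝ (p - p') (z - z') ≤ C * ‖y - y'‖ ^ 2 := by
      rw [h2, inner_sub_right, real_inner_smul_right]
      have := real_inner_self_nonneg (x := p - p')
      nlinarith
    have h4 : ‖y - y'‖ ^ 2 ≤ (2 * ‖z - z'‖) ^ 2 := by gcongr
    nlinarith

end SemiconcaveLipschitzOn

/-! ### The Euler scheme and the growth of its energy. -/

/-- Bounds for `H` and `H_p` on the compact set of relevant arguments. -/
structure HamiltonianBounds (H : Euc n → Euc n → ℝ → ℝ) (u : Euc n → ℝ) (c : Euc n)
    (r L M K : ℝ) : Prop where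
  M_pos : 0 < M
  K_nonneg : 0 ≤ K
  norm_gradP_le : ∀ y ∈ Metric.ball c (r / 2), ∀ p, ‖p‖ ≤ L → ‖gradP H y p (u y)‖ ≤ M
  lipschitz : ∀ y ∈ Metric.ball c (r / 2), ∀ y' ∈ Metric.ball c (r / 2), ∀ p, ‖p‖ ≤ L →
    H y p (u y) ≤ H y' p (u y') + K * ‖y - y'‖
  modulus : ∀ η > 0, ∃ δ > 0, ∀ y ∈ Metric.ball c (r / 2), ∀ p p', ‖p‖ ≤ L → ‖p'‖ ≤ L →
    ‖p - p'‖ < δ → ‖gradP H y p (u y) - gradP H y p' (u y)‖ ≤ η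

theorem SemiconcaveLipschitzOn.exists_hamiltonianBounds
    (hH : ContDiff ℝ 1 fun z : Euc n × Euc n × ℝ => H z.1 z.2.1 z.2.2)
    (h : SemiconcaveLipschitzOn u c r C L) : ∃ M K, HamiltonianBounds H u c r L M K := by
  have hr := h.r_pos
  have hL := h.L_nonneg
  set S : Set (Euc n × Euc n × ℝ) := Metric.closedBall c (r / 2) ×ˢ
    (Metric.closedBall 0 L ×ˢ Icc (u c - L * r) (u c + L * r)) with hS
  have hSc : IsCompact S :=
    (isCompact_closedBall _ _).prod ((isCompact_closedBall _ _).prod isCompact_Icc)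
  have hsub : Metric.ball c (r / 2) ⊆ Metric.ball c r := Metric.ball_subset_ball (by linarith)
  have hmem : ∀ y ∈ Metric.ball c (r / 2), ∀ p, ‖p‖ ≤ L → (y, p, u y) ∈ S := by
    intro y hy p hp
    refine ⟨Metric.ball_subset_closedBall hy, by simpa using hp, ?_⟩
    have h1 := h.lipschitz y (hsub hy) c (Metric.mem_ball_self hr)
    have h2 : L * ‖y - c‖ ≤ L * r := by
      rw [mem_ball_iff_norm] at hy
      gcongr
      linarith
    have h3 := abs_le.1 (h1.trans h2)
    exact ⟨by linarith [h3.1], by linarith [h3.2]⟩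
  obtain ⟨M, hM⟩ := hSc.exists_bound_of_continuousOn (continuous_gradP hH).continuousOn
  obtain ⟨K, hK⟩ :=
    (hH.locallyLipschitz.locallyLipschitzOn (s := S)).exists_lipschitzOnWith_of_compact hSc
  have huc := hSc.uniformContinuousOn_of_continuous (continuous_gradP hH).continuousOn
  refine ⟨max M 1, K * (1 + L), lt_max_of_lt_right one_pos, by positivity, fun y hy p hp =>
    (hM _ (hmem y hy p hp)).trans (le_max_left _ _), fun y hy y' hy' p hp => ?_, fun η hη => ?_⟩
  · have h1 := hK.dist_le_mul _ (hmem y hy p hp) _ (hmem y' hy' p hp)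
    have h2 : dist (y, p, u y) (y', p, u y') ≤ (1 + L) * ‖y - y'‖ := by
      have h3 := h.lipschitz y (hsub hy) y' (hsub hy')
      have := norm_nonneg (y - y')
      have := mul_nonneg hL this
      rw [Prod.dist_eq, Prod.dist_eq, dist_self, dist_eq_norm, Real.dist_eq]
      refine max_le (by linarith) (max_le (by nlinarith) (by linarith))
    have h4 := (le_abs_self _).trans h1
    have h5 : (K : ℝ) * dist (y, p, u y) (y', p, u y') ≤ K * ((1 + L) * ‖y - y'‖) := by gcongr
    simp only at h4
    linarith
  · obtain ⟨δ, hδ, hδ'⟩ := Metric.uniformContinuousOn_iff.1 huc η hη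
    refine ⟨δ, hδ, fun y hy p p' hp hp' hpp => ?_⟩
    have := hδ' _ (hmem y hy p hp) _ (hmem y hy p' hp') (by
      rw [Prod.dist_eq, Prod.dist_eq, dist_self, dist_self, dist_eq_norm]
      simpa [hδ] using hpp)
    rw [dist_eq_norm] at this
    exact this.le

/-- A discrete approximation with step `τ` and regularization parameter `ε` of a singular
characteristic from `c`, on the time interval `[0, T]`. -/
structure IsDiscreteCharacteristic (H : Euc n → Euc n → ℝ → ℝ) (u : Euc n → ℝ) (c : Euc n)
    (r M K T ε τ : ℝ) (z y p : ℕ → Euc n) : Prop where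
  τ_pos : 0 < τ
  τ_le : τ ≤ ε
  zero : z 0 = c
  norm_step_le : ∀ i, ‖z (i + 1) - z i‖ ≤ M * τ
  mem_ball : ∀ i : ℕ, i * τ ≤ T → y i ∈ Metric.ball c (r / 2)
  eq_add : ∀ i : ℕ, i * τ ≤ T → y i = z i + ε • p i
  mem_superdiff : ∀ i : ℕ, i * τ ≤ T → p i ∈ superdiff u (y i)
  step : ∀ i : ℕ, i * τ ≤ T → z (i + 1) = z i + τ • gradP H (y i) (p i) (u (y i))
  energy_le : ∀ i : ℕ, (i + 1) * τ ≤ T →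
    H (y (i + 1)) (p (i + 1)) (u (y (i + 1))) ≤ H (y i) (p i) (u (y i)) + K * τ
  value_le : ∀ i : ℕ, (i + 1) * τ ≤ T →
    u (y i) - ε / 2 * ‖p i‖ ^ 2 + inner ℝ (p i) (z (i + 1) - z i) - τ * ε ≤
      u (y (i + 1)) - ε / 2 * ‖p (i + 1)‖ ^ 2

theorem norm_iterate_sub_le {z : ℕ → Euc n} {b : ℝ} (h : ∀ i, ‖z (i + 1) - z i‖ ≤ b) {j k : ℕ}
    (hjk : j ≤ k) : ‖z k - z j‖ ≤ (k - j) * b := by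
  induction k, hjk using Nat.le_induction with
  | base => simp
  | succ k hk ih =>
    have h1 := norm_sub_le_norm_sub_add_norm_sub (z (k + 1)) (z k) (z j)
    have h2 := h k
    push_cast
    linarith

/-- The rate has three sources: `2KM` from the displacement of `y`, `4CM²` from the one-sided bound
on `⟨p' - p, z' - z⟩ = τ⟨p' - p, v⟩`, and `3M` from replacing `H_p` at `p'` by `H_p` at `p`. In the
last, the modulus `ε` of `H_p` cancels the Lipschitz constant `3/ε` of `p`. -/
theorem SemiconcaveLipschitzOn.energy_step_le
    (hH : ContDiff ℝ 1 fun z : Euc n × Euc n × ℝ => H z.1 z.2.1 z.2.2)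
    (hconv : ∀ x w, ConvexOn ℝ univ fun p => H x p w)
    (h : SemiconcaveLipschitzOn u c r C L) {M K τ δ : ℝ} (hB : HamiltonianBounds H u c r L M K)
    (hε : 0 < ε) (hεC : ε * C ≤ 1 / 2) (hτ : 0 < τ) (hτδ : 3 * M * τ < ε * δ)
    (hδ : ∀ y ∈ Metric.ball c (r / 2), ∀ p p', ‖p‖ ≤ L → ‖p'‖ ≤ L →
      ‖p - p'‖ < δ → ‖gradP H y p (u y) - gradP H y p' (u y)‖ ≤ ε)
    (hz : IsProximal u c r ε z y p) (hz' : IsProximal u c r ε z' y' p')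
    (hstep : z' = z + τ • gradP H y p (u y)) :
    H y' p' (u y') ≤ H y p (u y) + (2 * K * M + 4 * C * M ^ 2 + 3 * M) * τ := by
  have hsub : Metric.ball c (r / 2) ⊆ Metric.ball c r :=
    Metric.ball_subset_ball (by linarith [h.r_pos])
  have hp := h.norm_le (hsub hz.mem_ball) hz.mem_superdiff
  have hp' := h.norm_le (hsub hz'.mem_ball) hz'.mem_superdiff
  have hM := hB.M_pos
  have hC := h.C_pos
  obtain ⟨e1, e2, e3⟩ := h.isProximal_estimates hε hεC hz' hz
  set v := gradP H y p (u y)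
  have hv : ‖v‖ ≤ M := hB.norm_gradP_le y hz.mem_ball p hp
  have hzz : z' - z = τ • v := by rw [hstep]; abel
  have hzn : ‖z' - z‖ ≤ M * τ := by
    rw [hzz, norm_smul, Real.norm_of_nonneg hτ.le, mul_comm]; gcongr
  have h1 := hB.lipschitz y' hz'.mem_ball y hz.mem_ball p' hp'
  have h2 := add_inner_gradP_le hH (hconv y (u y)) p' p
  set v' := gradP H y p' (u y)
  have h3 : inner ℝ v (p' - p) ≤ 4 * C * M ^ 2 * τ := by
    rw [hzz, real_inner_smul_right, norm_smul, Real.norm_of_nonneg hτ.le, real_inner_comm] at e3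
    have : ‖v‖ ^ 2 ≤ M ^ 2 := by gcongr
    have h4 : τ * inner ℝ v (p' - p) ≤ τ * (4 * C * τ * ‖v‖ ^ 2) := by nlinarith
    have h5 := le_of_mul_le_mul_left h4 hτ
    have h6 : 4 * C * τ * ‖v‖ ^ 2 ≤ 4 * C * τ * M ^ 2 := by gcongr
    linarith
  have hpp : ε * ‖p' - p‖ ≤ 3 * M * τ := by linarith
  have h4 : ‖v' - v‖ ≤ ε := by
    refine hδ y hz.mem_ball p' p hp' hp ?_
    exact lt_of_mul_lt_mul_left (hpp.trans_lt hτδ) hε.le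
  have h5 : inner ℝ (v' - v) (p' - p) ≤ 3 * M * τ := by
    calc _ ≤ ‖v' - v‖ * ‖p' - p‖ := real_inner_le_norm _ _
      _ ≤ ε * ‖p' - p‖ := by gcongr
      _ ≤ _ := hpp
  have h6 : K * ‖y' - y‖ ≤ 2 * K * M * τ := by
    have := hB.K_nonneg
    calc K * ‖y' - y‖ ≤ K * (2 * (M * τ)) := by gcongr; linarith
      _ = _ := by ring
  rw [← neg_sub p' p, inner_neg_right] at h2
  rw [inner_sub_left] at h5
  linarith

theorem SemiconcaveLipschitzOn.exists_isDiscreteCharacteristic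
    (hH : ContDiff ℝ 1 fun z : Euc n × Euc n × ℝ => H z.1 z.2.1 z.2.2)
    (hconv : ∀ x w, ConvexOn ℝ univ fun p => H x p w)
    (h : SemiconcaveLipschitzOn u c r C L) {M K T : ℝ} (hB : HamiltonianBounds H u c r L M K)
    (hT : M * T ≤ r / 4)
    (hε : 0 < ε) (hεC : ε * C ≤ 1 / 2) (hεL : 2 * ε * L < r / 4) :
    ∃ τ z y p,
      IsDiscreteCharacteristic H u c r M (2 * K * M + 4 * C * M ^ 2 + 3 * M) T ε τ z y p := by
  classical
  obtain ⟨δ, hδ, hδ'⟩ := hB.modulus ε hε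
  have hM := hB.M_pos
  -- The second bound keeps consecutive supergradients within `δ`; the third makes the quadratic
  -- error `‖z(i+1) - z(i)‖² / (2ε)` at most `τε`.
  obtain ⟨τ, hτ, hτ1⟩ : ∃ τ > 0, τ < min ε (min (ε * δ / (3 * M)) (2 * ε ^ 2 / M ^ 2)) :=
    exists_between (by positivity)
  obtain ⟨hτε, hτ2⟩ := lt_min_iff.1 hτ1
  obtain ⟨hτδ, hτM⟩ := lt_min_iff.1 hτ2
  rw [lt_div_iff₀ (by positivity)] at hτδ hτM
  have hsub : Metric.ball c (r / 2) ⊆ Metric.ball c r :=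
    Metric.ball_subset_ball (by linarith [h.r_pos])
  have hex : ∀ z : Euc n, ∃ y p, ‖z - c‖ ≤ r / 4 → IsProximal u c r ε z y p := fun z => by
    by_cases hz : ‖z - c‖ ≤ r / 4
    · obtain ⟨y, p, hyp⟩ := h.exists_isProximal hε hεL hz
      exact ⟨y, p, fun _ => hyp⟩
    · exact ⟨0, 0, fun hz' => absurd hz' hz⟩
  choose Y P hYP using hex
  -- The value `0` away from the small ball makes the iteration and its step bound global; up to
  -- time `T` the ball is never left.
  let V : Euc n → Euc n := fun z => if ‖z - c‖ ≤ r / 4 then gradP H (Y z) (P z) (u (Y z)) else 0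
  have hV : ∀ z, ‖V z‖ ≤ M := by
    intro z
    by_cases hz : ‖z - c‖ ≤ r / 4
    · have hx := hYP z hz
      simp only [V, if_pos hz]
      exact hB.norm_gradP_le _ hx.mem_ball _ (h.norm_le (hsub hx.mem_ball) hx.mem_superdiff)
    · simp only [V, if_neg hz, norm_zero]; exact hM.le
  let z : ℕ → Euc n := fun i => (fun x => x + τ • V x)^[i] c
  have hz0 : z 0 = c := rfl
  have hzs : ∀ i, z (i + 1) = z i + τ • V (z i) := fun i => Function.iterate_succ_apply' _ _ _
  have hstep : ∀ i, ‖z (i + 1) - z i‖ ≤ M * τ := by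
    intro i
    rw [hzs, add_sub_cancel_left, norm_smul, Real.norm_of_nonneg hτ.le, mul_comm]
    gcongr
    exact hV _
  have hball : ∀ i : ℕ, i * τ ≤ T → ‖z i - c‖ ≤ r / 4 := by
    intro i hi
    have h1 := norm_iterate_sub_le hstep (Nat.zero_le i)
    rw [hz0, Nat.cast_zero, sub_zero] at h1
    nlinarith
  have hprox : ∀ i : ℕ, i * τ ≤ T → IsProximal u c r ε (z i) (Y (z i)) (P (z i)) :=
    fun i hi => hYP _ (hball i hi)
  have hzV : ∀ i : ℕ, i * τ ≤ T →
      z (i + 1) = z i + τ • gradP H (Y (z i)) (P (z i)) (u (Y (z i))) := by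
    intro i hi
    rw [hzs]
    simp only [V, if_pos (hball i hi)]
  have hpred : ∀ i : ℕ, (i + 1) * τ ≤ T → i * τ ≤ T := fun i hi => by nlinarith
  have hsucc : ∀ i : ℕ, (i + 1) * τ ≤ T → ((i + 1 : ℕ) : ℝ) * τ ≤ T := fun i hi => by
    push_cast; exact hi
  refine ⟨τ, z, fun i => Y (z i), fun i => P (z i), hτ, hτε.le, hz0, hstep,
    fun i hi => (hprox i hi).mem_ball, fun i hi => (hprox i hi).eq_add,
    fun i hi => (hprox i hi).mem_superdiff, hzV, fun i hi => ?_, fun i hi => ?_⟩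
  · exact h.energy_step_le hH hconv hB hε hεC hτ (by linarith) hδ' (hprox i (hpred i hi))
      (hprox (i + 1) (hsucc i hi)) (hzV i (hpred i hi))
  -- The old maximizer is a competitor for the new sup-convolution problem.
  · have h1 := (hprox (i + 1) (hsucc i hi)).le _ (hprox i (hpred i hi)).mem_ball
    have h2 : Y (z i) - z (i + 1) = ε • P (z i) - (z (i + 1) - z i) := by
      conv_lhs => rw [(hprox i (hpred i hi)).eq_add]
      abel
    have h3 : ‖Y (z i) - z (i + 1)‖ ^ 2 / (2 * ε) = ε / 2 * ‖P (z i)‖ ^ 2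
        - inner ℝ (P (z i)) (z (i + 1) - z i) + ‖z (i + 1) - z i‖ ^ 2 / (2 * ε) := by
      rw [h2, norm_sub_sq_real, norm_smul, real_inner_smul_left, Real.norm_of_nonneg hε.le]
      field_simp
    have h4 : ‖z (i + 1) - z i‖ ^ 2 / (2 * ε) ≤ τ * ε := by
      rw [div_le_iff₀ (by positivity)]
      calc _ ≤ (M * τ) ^ 2 := by gcongr; exact hstep i
        _ = τ * (τ * M ^ 2) := by ring
        _ ≤ τ * (2 * ε ^ 2) := by gcongr
        _ = _ := by ring
    linarith

end HJ

/-! ### Summed estimates for the scheme and passage to the limit. -/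

namespace HJ

variable {n : ℕ} {u : Euc n → ℝ} {Ω : Set (Euc n)} {c x q : Euc n}
  {r C L M K K₀ T : ℝ} {H : Euc n → Euc n → ℝ → ℝ}

namespace IsDiscreteCharacteristic

variable {ε τ : ℝ} {z y p : ℕ → Euc n} {i j m : ℕ}

theorem time_le (h : IsDiscreteCharacteristic H u c r M K T ε τ z y p) (hij : i ≤ j)
    (hj : j * τ ≤ T) : i * τ ≤ T := by
  have := h.τ_pos
  refine le_trans ?_ hj
  gcongr

theorem energy_le_of_le (h : IsDiscreteCharacteristic H u c r M K T ε τ z y p) (hjm : j ≤ m)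
    (hm : m * τ ≤ T) :
    H (y m) (p m) (u (y m)) ≤ H (y j) (p j) (u (y j)) + K * ((m - j) * τ) := by
  induction m, hjm using Nat.le_induction with
  | base => simp
  | succ m hjm ih =>
    have h1 := ih (h.time_le (Nat.le_succ m) hm)
    have h2 := h.energy_le m (by exact_mod_cast hm)
    push_cast
    linarith

theorem norm_sub_le (hs : SemiconcaveLipschitzOn u c r C L)
    (h : IsDiscreteCharacteristic H u c r M K T ε τ z y p) (hji : j ≤ i)
    (hi : i * τ ≤ T) (x : Euc n) :
    ‖y i - x‖ ≤ M * ((i - j) * τ) + ‖z j - x‖ + ε * L := by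
  have hsub : Metric.ball c (r / 2) ⊆ Metric.ball c r :=
    Metric.ball_subset_ball (by linarith [hs.r_pos])
  have hε := h.τ_pos.trans_le h.τ_le
  have h1 := norm_iterate_sub_le h.norm_step_le hji
  have h2 := hs.norm_le (hsub (h.mem_ball i hi)) (h.mem_superdiff i hi)
  have h3 : y i - x = (z i - z j) + (z j - x) + ε • p i := by rw [h.eq_add i hi]; abel
  have h4 : ‖ε • p i‖ ≤ ε * L := by rw [norm_smul, Real.norm_of_nonneg hε.le]; gcongr
  rw [h3]
  refine norm_add₃_le.trans ?_
  linarith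

/-- Comparison of the energy at a later step with the energy of a fixed covector `q`. -/
theorem energy_sub_mul_le
    (hH : ContDiff ℝ 1 fun z : Euc n × Euc n × ℝ => H z.1 z.2.1 z.2.2)
    (hconv : ∀ x w, ConvexOn ℝ univ fun p => H x p w)
    (hs : SemiconcaveLipschitzOn u c r C L) (hB : HamiltonianBounds H u c r L M K₀)
    (h : IsDiscreteCharacteristic H u c r M K T ε τ z y p) (hK : 0 ≤ K)
    (hx : x ∈ Metric.ball c (r / 2)) (hq : q ∈ superdiff u x) (hji : j ≤ i) (him : i ≤ m)
    (hm : m * τ ≤ T) :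
    (i - j) * τ * (H (y m) (p m) (u (y m)) - K * ((m - j) * τ) - H x q (u x)
      - K₀ * (M * ((m - j) * τ) + ‖z j - x‖ + ε * L)) ≤
    (u (y i) - ε / 2 * ‖p i‖ ^ 2) - (u (y j) - ε / 2 * ‖p j‖ ^ 2) - inner ℝ q (z i - z j)
      + (i - j) * τ * ε := by
  have hsub : Metric.ball c (r / 2) ⊆ Metric.ball c r :=
    Metric.ball_subset_ball (by linarith [hs.r_pos])
  have hτ := h.τ_pos
  have hM := hB.M_pos
  have hK₀ := hB.K_nonneg
  induction i, hji using Nat.le_induction with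
  | base => simp
  | succ i hji ih =>
    have h1 := ih ((Nat.le_succ i).trans him)
    have hi1 : (i + 1 : ℕ) * τ ≤ T := h.time_le him hm
    have hi : i * τ ≤ T := h.time_le (Nat.le_succ i) hi1
    have h2 := h.value_le i (by exact_mod_cast hi1)
    have h3 := h.energy_le_of_le ((Nat.le_succ i).trans him) hm
    have h4 := norm_sub_le hs h hji hi x
    have h5 := hB.lipschitz (y i) (h.mem_ball i hi) x hx q (hs.norm_le (hsub hx) hq)
    have h6 := add_inner_gradP_le hH (hconv (y i) (u (y i))) (p i) q
    have hij : (j : ℝ) ≤ i := by exact_mod_cast hji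
    have him' : (i : ℝ) + 1 ≤ m := by exact_mod_cast him
    have h7 : K * ((m - i) * τ) ≤ K * ((m - j) * τ) := by gcongr
    have h8 : K₀ * ‖y i - x‖ ≤ K₀ * (M * ((m - j) * τ) + ‖z j - x‖ + ε * L) := by
      refine mul_le_mul_of_nonneg_left (h4.trans ?_) hK₀
      gcongr
      linarith
    have h9 := h.step i hi
    set v := gradP H (y i) (p i) (u (y i))
    have h10 : z (i + 1) - z i = τ • v := by rw [h9]; abel
    have h11 : z (i + 1) - z j = (z i - z j) + τ • v := by rw [h9]; abel
    rw [h10, real_inner_smul_right] at h2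
    rw [h11, inner_add_right, real_inner_smul_right]
    rw [inner_sub_right, real_inner_comm (p i), real_inner_comm q] at h6
    -- The final index `m` is fixed while `i` grows, so `A` bounds every increment from below with
    -- the same constant: by almost-monotonicity, the energy at `m` controls all earlier ones.
    set A := H (y m) (p m) (u (y m)) - K * ((m - j) * τ) - H x q (u x)
      - K₀ * (M * ((m - j) * τ) + ‖z j - x‖ + ε * L) with hA
    have h12 : A ≤ inner ℝ (p i) v - inner ℝ q v := by linarith
    have h13 : τ * A ≤ τ * (inner ℝ (p i) v - inner ℝ q v) := by gcongr
    push_cast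
    linarith

theorem norm_displacement_sub_le
    (h : IsDiscreteCharacteristic H u c r M K T ε τ z y p) {v : Euc n} {η : ℝ} (hjm : j ≤ m)
    (hm : m * τ ≤ T)
    (hv : ∀ i, j ≤ i → i < m → ‖gradP H (y i) (p i) (u (y i)) - v‖ ≤ η) :
    ‖z m - z j - ((m - j) * τ) • v‖ ≤ (m - j) * τ * η := by
  have hτ := h.τ_pos
  induction m, hjm using Nat.le_induction with
  | base => simp
  | succ m hjm ih =>
    have hm' := h.time_le (Nat.le_succ m) hm
    have h1 := ih hm' fun i hi hi' => hv i hi (hi'.trans (Nat.lt_succ_self m))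
    have h2 := hv m hjm (Nat.lt_succ_self m)
    have h3 := h.step m hm'
    set w := gradP H (y m) (p m) (u (y m))
    have h4 : z (m + 1) - z j - (((m + 1 : ℕ) - j) * τ) • v =
        (z m - z j - ((m - j) * τ) • v) + τ • (w - v) := by
      rw [h3]; push_cast; module
    have h5 : ‖τ • (w - v)‖ ≤ τ * η := by
      rw [norm_smul, Real.norm_of_nonneg hτ.le]; gcongr
    rw [h4]
    refine (norm_add_le _ _).trans ?_
    push_cast
    linarith

end IsDiscreteCharacteristic

theorem SemiconcaveLipschitzOn.exists_forall_norm_gradP_sub_vSharp_le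
    (hH : ContDiff ℝ 1 fun z : Euc n × Euc n × ℝ => H z.1 z.2.1 z.2.2)
    (hconv : ∀ x w, StrictConvexOn ℝ univ fun p => H x p w)
    (hu : IsSemiconcaveSolution H Ω u) (h : SemiconcaveLipschitzOn u c r C L)
    (hΩ : Metric.ball c r ⊆ Ω) (hx : x ∈ Metric.ball c r) {η : ℝ} (hη : 0 < η) :
    ∃ δ > 0, ∀ y p, ‖y - x‖ < δ → p ∈ superdiff u y →
      H y p (u y) < H x (pSharp H u x) (u x) + δ →
      ‖gradP H y p (u y) - vSharp H u x‖ ≤ η := by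
  have h1 : Tendsto (fun z : Euc n × Euc n => gradP H z.1 z.2 (u z.1)) (𝓝 (x, pSharp H u x))
      (𝓝 (vSharp H u x)) := by
    have h2 : Tendsto (fun z : Euc n × Euc n => u z.1) (𝓝 (x, pSharp H u x)) (𝓝 (u x)) :=
      Tendsto.comp (h.continuousAt hx) (continuous_fst.tendsto (x, pSharp H u x))
    have h3 : Tendsto (fun z : Euc n × Euc n => (z.1, z.2, u z.1)) (𝓝 (x, pSharp H u x))
        (𝓝 (x, pSharp H u x, u x)) :=
      (continuous_fst.tendsto (x, pSharp H u x)).prodMk_nhds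
        ((continuous_snd.tendsto (x, pSharp H u x)).prodMk_nhds h2)
    have h4 := ((continuous_gradP hH).tendsto (x, pSharp H u x, u x)).comp h3
    exact h4
  obtain ⟨δ₁, hδ₁, h2⟩ := Metric.tendsto_nhds_nhds.1 h1 η hη
  obtain ⟨δ₂, hδ₂, h3⟩ := h.exists_forall_dist_pSharp_lt hH.continuous hconv hu hΩ hx hδ₁
  refine ⟨min δ₁ δ₂, lt_min hδ₁ hδ₂, fun y p hy hp hE => ?_⟩
  have h4 := h3 y p (hy.trans_le (min_le_right _ _)) hp
    (hE.trans_le (by have := min_le_right δ₁ δ₂; linarith))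
  have h5 := @h2 (y, p) (by
    rw [Prod.dist_eq, dist_eq_norm, dist_eq_norm]
    exact max_lt (hy.trans_le (min_le_left _ _)) h4)
  rw [dist_eq_norm] at h5
  exact h5.le

/-- `γ` is a limit of discrete characteristics with vanishing steps, and `P` is the limit of the
corresponding supergradients. -/
structure IsLimitCharacteristic (H : Euc n → Euc n → ℝ → ℝ) (u : Euc n → ℝ) (c : Euc n)
    (r C L M K₀ K T : ℝ) (ε τ : ℕ → ℝ) (z y p : ℕ → ℕ → Euc n) (γ P : ℝ → Euc n) : Prop where
  semiconcaveLipschitzOn : SemiconcaveLipschitzOn u c r C L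
  bounds : HamiltonianBounds H u c r L M K₀
  K_nonneg : 0 ≤ K
  mul_le : M * T ≤ r / 4
  discrete : ∀ k, IsDiscreteCharacteristic H u c r M K T (ε k) (τ k) (z k) (y k) (p k)
  tendsto_ε : Tendsto ε (hyperfilter ℕ) (𝓝 0)
  tendsto_z : ∀ t ∈ Icc 0 T, Tendsto (fun k => z k ⌊t / τ k⌋₊) (hyperfilter ℕ) (𝓝 (γ t))
  tendsto_p : ∀ t ∈ Icc 0 T, Tendsto (fun k => p k ⌊t / τ k⌋₊) (hyperfilter ℕ) (𝓝 (P t))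

theorem floor_mul_le {t τ : ℝ} (ht : 0 ≤ t) (hτ : 0 < τ) : (⌊t / τ⌋₊ : ℝ) * τ ≤ t := by
  rw [← le_div_iff₀ hτ]
  exact Nat.floor_le (by positivity)

/-- Limits along one ultrafilter exist at all times simultaneously, so neither a subsequence nor
equicontinuity is needed, and the supergradients, which have no modulus in time, converge pointwise
as well. -/
theorem SemiconcaveLipschitzOn.exists_isLimitCharacteristic
    (hH : ContDiff ℝ 1 fun z : Euc n × Euc n × ℝ => H z.1 z.2.1 z.2.2)
    (hconv : ∀ x w, ConvexOn ℝ univ fun p => H x p w)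
    (h : SemiconcaveLipschitzOn u c r C L) :
    ∃ M K₀ K T ε τ z y p γ P, 0 < T ∧ IsLimitCharacteristic H u c r C L M K₀ K T ε τ z y p γ P := by
  obtain ⟨M, K₀, hB⟩ := h.exists_hamiltonianBounds hH
  have hr := h.r_pos
  have hM := hB.M_pos
  have hC := h.C_pos
  have hL := h.L_nonneg
  have hK₀ := hB.K_nonneg
  set T := r / (4 * M)
  have hMT : M * T ≤ r / 4 := le_of_eq (by simp only [T]; field_simp)
  have hT : 0 < T := by positivity
  -- These bounds give `ε₀ * C < 1 / 2` and `2 * ε₀ * L < r / 4`, as the sup-convolution requires.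
  obtain ⟨ε₀, hε₀, hε₀'⟩ : ∃ ε₀ > 0, ε₀ < min (1 / (2 * C)) (r / (8 * (L + 1))) :=
    exists_between (by positivity)
  obtain ⟨h1, h2⟩ := lt_min_iff.1 hε₀'
  rw [lt_div_iff₀ (by positivity)] at h1 h2
  have hk : ∀ k : ℕ, 0 < 1 / (k + 1 : ℝ) ∧ 1 / (k + 1 : ℝ) ≤ 1 := fun k =>
    ⟨by positivity, by rw [div_le_one (by positivity)]; linarith [k.cast_nonneg (α := ℝ)]⟩
  have hle : ∀ k : ℕ, ε₀ * (1 / (k + 1 : ℝ)) ≤ ε₀ := fun k =>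
    mul_le_of_le_one_right hε₀.le (hk k).2
  have hex : ∀ k : ℕ, ∃ τ z y p, IsDiscreteCharacteristic H u c r M
      (2 * K₀ * M + 4 * C * M ^ 2 + 3 * M) T (ε₀ * (1 / (k + 1 : ℝ))) τ z y p := by
    intro k
    refine h.exists_isDiscreteCharacteristic hH hconv hB hMT (mul_pos hε₀ (hk k).1) ?_ ?_
    · have : ε₀ * (1 / (k + 1 : ℝ)) * C ≤ ε₀ * C := by gcongr; exact hle k
      linarith
    · have : 2 * (ε₀ * (1 / (k + 1 : ℝ))) * L ≤ 2 * ε₀ * L := by gcongr; exact hle k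
      linarith
  choose τ z y p hD using hex
  have hsub : Metric.ball c (r / 2) ⊆ Metric.ball c r := Metric.ball_subset_ball (by linarith)
  have hidx : ∀ t ∈ Icc 0 T, ∀ k, (⌊t / τ k⌋₊ : ℝ) * τ k ≤ T := fun t ht k =>
    (floor_mul_le ht.1 (hD k).τ_pos).trans ht.2
  have hz : ∀ t, ∃ x, t ∈ Icc 0 T → Tendsto (fun k => z k ⌊t / τ k⌋₊) (hyperfilter ℕ) (𝓝 x) := by
    intro t
    by_cases ht : t ∈ Icc 0 T
    · obtain ⟨x, hx⟩ := exists_tendsto_of_norm_le (hyperfilter ℕ)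
        (X := fun k => z k ⌊t / τ k⌋₊) (R := M * T + ‖c‖) (Eventually.of_forall fun k => by
          have h3 := norm_iterate_sub_le (hD k).norm_step_le (Nat.zero_le ⌊t / τ k⌋₊)
          rw [(hD k).zero, Nat.cast_zero, sub_zero] at h3
          have h4 : M * (⌊t / τ k⌋₊ * τ k) ≤ M * T := by gcongr; exact hidx t ht k
          have h5 := norm_sub_norm_le (z k ⌊t / τ k⌋₊) c
          linarith)
      exact ⟨x, fun _ => hx⟩
    · exact ⟨0, fun ht' => absurd ht' ht⟩
  have hp : ∀ t, ∃ x, t ∈ Icc 0 T → Tendsto (fun k => p k ⌊t / τ k⌋₊) (hyperfilter ℕ) (𝓝 x) := by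
    intro t
    by_cases ht : t ∈ Icc 0 T
    · obtain ⟨x, hx⟩ := exists_tendsto_of_norm_le (hyperfilter ℕ)
        (X := fun k => p k ⌊t / τ k⌋₊) (R := L) (Eventually.of_forall fun k =>
          h.norm_le (hsub ((hD k).mem_ball _ (hidx t ht k))) ((hD k).mem_superdiff _ (hidx t ht k)))
      exact ⟨x, fun _ => hx⟩
    · exact ⟨0, fun ht' => absurd ht' ht⟩
  choose γ hγ using hz
  choose P hP using hp
  refine ⟨M, K₀, _, T, _, τ, z, y, p, γ, P, hT, h, hB, by positivity, hMT, hD, ?_, hγ, hP⟩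
  have ht : Tendsto (fun k : ℕ => 1 / (k + 1 : ℝ)) (hyperfilter ℕ) (𝓝 0) :=
    tendsto_one_div_add_atTop_nhds_zero_nat.mono_left Nat.hyperfilter_le_atTop
  simpa using ht.const_mul ε₀

end HJ

/-! ### Properties of the limit curve. -/

namespace HJ

variable {n : ℕ} {u : Euc n → ℝ} {Ω : Set (Euc n)} {c x q : Euc n}
  {r C L M K K₀ T s t : ℝ} {H : Euc n → Euc n → ℝ → ℝ} {ε τ : ℕ → ℝ} {z y p : ℕ → ℕ → Euc n}
  {γ P : ℝ → Euc n}

namespace IsLimitCharacteristic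

theorem index_mul_le (h : IsLimitCharacteristic H u c r C L M K₀ K T ε τ z y p γ P)
    (ht : t ∈ Icc 0 T) (k : ℕ) : (⌊t / τ k⌋₊ : ℝ) * τ k ≤ T :=
  (floor_mul_le ht.1 (h.discrete k).τ_pos).trans ht.2

theorem index_mono (h : IsLimitCharacteristic H u c r C L M K₀ K T ε τ z y p γ P)
    (hst : s ≤ t) (k : ℕ) : ⌊s / τ k⌋₊ ≤ ⌊t / τ k⌋₊ := by
  have := (h.discrete k).τ_pos
  gcongr

theorem tendsto_τ (h : IsLimitCharacteristic H u c r C L M K₀ K T ε τ z y p γ P) :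
    Tendsto τ (hyperfilter ℕ) (𝓝 0) :=
  squeeze_zero (fun k => (h.discrete k).τ_pos.le) (fun k => (h.discrete k).τ_le) h.tendsto_ε

theorem tendsto_time (h : IsLimitCharacteristic H u c r C L M K₀ K T ε τ z y p γ P)
    (ht : 0 ≤ t) : Tendsto (fun k => (⌊t / τ k⌋₊ : ℝ) * τ k) (hyperfilter ℕ) (𝓝 t) := by
  have h1 : Tendsto (fun k => t - τ k) (hyperfilter ℕ) (𝓝 (t - 0)) := h.tendsto_τ.const_sub t
  rw [sub_zero] at h1
  refine tendsto_of_tendsto_of_tendsto_of_le_of_le h1 tendsto_const_nhds (fun k => ?_)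
    fun k => floor_mul_le ht (h.discrete k).τ_pos
  have h2 := (h.discrete k).τ_pos
  have h3 := Nat.lt_floor_add_one (t / τ k)
  rw [div_lt_iff₀ h2] at h3
  simp only
  linarith

theorem tendsto_time_sub (h : IsLimitCharacteristic H u c r C L M K₀ K T ε τ z y p γ P)
    (hs : 0 ≤ s) (ht : 0 ≤ t) :
    Tendsto (fun k => ((⌊t / τ k⌋₊ : ℝ) - ⌊s / τ k⌋₊) * τ k) (hyperfilter ℕ) (𝓝 (t - s)) :=
  ((h.tendsto_time ht).sub (h.tendsto_time hs)).congr fun k => by ring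

theorem zero (h : IsLimitCharacteristic H u c r C L M K₀ K T ε τ z y p γ P) (hT : 0 ≤ T) :
    γ 0 = c := by
  have h1 := h.tendsto_z 0 ⟨le_rfl, hT⟩
  refine tendsto_nhds_unique h1 (tendsto_const_nhds.congr fun k => ?_)
  rw [zero_div, Nat.floor_zero, (h.discrete k).zero]

theorem norm_sub_le (h : IsLimitCharacteristic H u c r C L M K₀ K T ε τ z y p γ P)
    (hs : 0 ≤ s) (hst : s ≤ t) (ht : t ≤ T) : ‖γ t - γ s‖ ≤ M * (t - s) := by
  refine le_of_tendsto_of_tendsto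
    ((h.tendsto_z t ⟨hs.trans hst, ht⟩).sub (h.tendsto_z s ⟨hs, hst.trans ht⟩)).norm
    ((h.tendsto_time_sub hs (hs.trans hst)).const_mul M) (Eventually.of_forall fun k => ?_)
  have := norm_iterate_sub_le (h.discrete k).norm_step_le (h.index_mono hst k)
  simp only
  linarith

theorem lipschitzOnWith (h : IsLimitCharacteristic H u c r C L M K₀ K T ε τ z y p γ P) :
    LipschitzOnWith M.toNNReal γ (Icc 0 T) := by
  have hM := h.bounds.M_pos
  refine LipschitzOnWith.of_dist_le_mul fun t ht s hs => ?_
  rw [Real.coe_toNNReal _ hM.le, dist_eq_norm, Real.dist_eq]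
  rcases le_total s t with hst | hst
  · rw [abs_of_nonneg (sub_nonneg.2 hst)]
    exact h.norm_sub_le hs.1 hst ht.2
  · rw [norm_sub_rev, abs_sub_comm, abs_of_nonneg (sub_nonneg.2 hst)]
    exact h.norm_sub_le ht.1 hst hs.2

theorem mem_ball_half (h : IsLimitCharacteristic H u c r C L M K₀ K T ε τ z y p γ P)
    (ht : t ∈ Icc 0 T) : γ t ∈ Metric.ball c (r / 2) := by
  have h1 := h.norm_sub_le le_rfl ht.1 ht.2
  rw [h.zero (ht.1.trans ht.2), sub_zero] at h1
  have hM := h.bounds.M_pos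
  have h2 : M * t ≤ M * T := by gcongr; exact ht.2
  have := h.mul_le
  have := h.semiconcaveLipschitzOn.r_pos
  rw [mem_ball_iff_norm]
  linarith

theorem mem_ball (h : IsLimitCharacteristic H u c r C L M K₀ K T ε τ z y p γ P)
    (ht : t ∈ Icc 0 T) : γ t ∈ Metric.ball c r :=
  Metric.ball_subset_ball (by linarith [h.semiconcaveLipschitzOn.r_pos]) (h.mem_ball_half ht)

theorem tendsto_y (h : IsLimitCharacteristic H u c r C L M K₀ K T ε τ z y p γ P)
    (ht : t ∈ Icc 0 T) :
    Tendsto (fun k => y k ⌊t / τ k⌋₊) (hyperfilter ℕ) (𝓝 (γ t)) := by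
  have h1 := (h.tendsto_z t ht).add (h.tendsto_ε.smul (h.tendsto_p t ht))
  rw [zero_smul, add_zero] at h1
  exact h1.congr fun k => ((h.discrete k).eq_add _ (h.index_mul_le ht k)).symm

theorem tendsto_u (h : IsLimitCharacteristic H u c r C L M K₀ K T ε τ z y p γ P)
    (ht : t ∈ Icc 0 T) :
    Tendsto (fun k => u (y k ⌊t / τ k⌋₊)) (hyperfilter ℕ) (𝓝 (u (γ t))) :=
  (h.semiconcaveLipschitzOn.continuousAt (h.mem_ball ht)).tendsto.comp (h.tendsto_y ht)

theorem mem_superdiff (h : IsLimitCharacteristic H u c r C L M K₀ K T ε τ z y p γ P)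
    (ht : t ∈ Icc 0 T) : P t ∈ superdiff u (γ t) :=
  h.semiconcaveLipschitzOn.mem_superdiff_of_tendsto (h.mem_ball ht) (h.tendsto_y ht)
    (h.tendsto_p t ht) (Eventually.of_forall fun k =>
      (h.discrete k).mem_superdiff _ (h.index_mul_le ht k))

theorem tendsto_energy (hH : Continuous fun z : Euc n × Euc n × ℝ => H z.1 z.2.1 z.2.2)
    (h : IsLimitCharacteristic H u c r C L M K₀ K T ε τ z y p γ P) (ht : t ∈ Icc 0 T) :
    Tendsto (fun k => H (y k ⌊t / τ k⌋₊) (p k ⌊t / τ k⌋₊) (u (y k ⌊t / τ k⌋₊))) (hyperfilter ℕ)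
      (𝓝 (H (γ t) (P t) (u (γ t)))) :=
  (hH.tendsto (γ t, P t, u (γ t))).comp
    ((h.tendsto_y ht).prodMk_nhds ((h.tendsto_p t ht).prodMk_nhds (h.tendsto_u ht)))

/-- The energy of the limit supergradient at a later time is controlled by the energy of every
supergradient at an earlier time. -/
theorem energy_le_add
    (hH : ContDiff ℝ 1 fun z : Euc n × Euc n × ℝ => H z.1 z.2.1 z.2.2)
    (hconv : ∀ x w, ConvexOn ℝ univ fun p => H x p w)
    (h : IsLimitCharacteristic H u c r C L M K₀ K T ε τ z y p γ P) (ht : 0 ≤ t) (hts : t < s)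
    (hs : s ≤ T) (hq : q ∈ superdiff u (γ t)) :
    H (γ s) (P s) (u (γ s)) ≤
      H (γ t) q (u (γ t)) + (K + K₀ * M + C / 2 * M ^ 2) * (s - t) := by
  have hs' : s ∈ Icc 0 T := ⟨ht.trans hts.le, hs⟩
  have ht' : t ∈ Icc 0 T := ⟨ht, hts.le.trans hs⟩
  have hC := h.semiconcaveLipschitzOn.C_pos
  have hd := h.tendsto_time_sub ht hs'.1
  have h0 : Tendsto (fun k => ‖z k ⌊t / τ k⌋₊ - γ t‖) (hyperfilter ℕ) (𝓝 0) :=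
    tendsto_iff_norm_sub_tendsto_zero.1 (h.tendsto_z t ht')
  have h1 := hd.mul ((((h.tendsto_energy hH.continuous hs').sub (hd.const_mul K)).sub_const
    (H (γ t) q (u (γ t)))).sub
      ((((hd.const_mul M).add h0).add (h.tendsto_ε.mul_const L)).const_mul K₀))
  have h2 : ∀ t ∈ Icc 0 T, Tendsto (fun k => u (y k ⌊t / τ k⌋₊)
      - ε k / 2 * ‖p k ⌊t / τ k⌋₊‖ ^ 2) (hyperfilter ℕ) (𝓝 (u (γ t) - 0 / 2 * ‖P t‖ ^ 2)) :=
    fun t ht => (h.tendsto_u ht).sub ((h.tendsto_ε.div_const 2).mul ((h.tendsto_p t ht).norm.pow 2))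
  have h3 := (((h2 s hs').sub (h2 t ht')).sub ((tendsto_const_nhds (x := q)).inner
    ((h.tendsto_z s hs').sub (h.tendsto_z t ht')))).add (hd.mul h.tendsto_ε)
  -- The discrete comparison is used with `i = m`. In the limit the terms in `ε` and `‖z j - γ t‖`
  -- vanish, and semiconcavity at `γ t` bounds the right side by `C / 2 * (M * (s - t)) ^ 2`.
  have h4 := le_of_tendsto_of_tendsto h1 h3 (Eventually.of_forall fun k =>
    (h.discrete k).energy_sub_mul_le hH hconv h.semiconcaveLipschitzOn h.bounds h.K_nonneg
      (h.mem_ball_half ht') hq (h.index_mono hts.le k) le_rfl (h.index_mul_le hs' k))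
  have h5 := (h.semiconcaveLipschitzOn.mem_superdiff_iff (h.mem_ball ht')).1 hq _ (h.mem_ball hs')
  have h6 : ‖γ s - γ t‖ ^ 2 ≤ (M * (s - t)) ^ 2 := by
    gcongr; exact h.norm_sub_le ht hts.le hs
  have h7 : C / 2 * ‖γ s - γ t‖ ^ 2 ≤ C / 2 * (M * (s - t)) ^ 2 := by gcongr
  have hst : 0 < s - t := sub_pos.2 hts
  have h8 : (s - t) * (H (γ s) (P s) (u (γ s))) ≤ (s - t) * (H (γ t) q (u (γ t)) +
      (K + K₀ * M + C / 2 * M ^ 2) * (s - t)) := by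
    linarith
  exact le_of_mul_le_mul_left h8 hst

theorem minimal_energy_le_add
    (hH : ContDiff ℝ 1 fun z : Euc n × Euc n × ℝ => H z.1 z.2.1 z.2.2)
    (hconv : ∀ x w, StrictConvexOn ℝ univ fun p => H x p w)
    (hu : IsSemiconcaveSolution H Ω u) (hΩ : Metric.ball c r ⊆ Ω)
    (h : IsLimitCharacteristic H u c r C L M K₀ K T ε τ z y p γ P) (ht : 0 ≤ t) (hts : t ≤ s)
    (hs : s ≤ T) :
    H (γ s) (pSharp H u (γ s)) (u (γ s)) ≤ H (γ t) (pSharp H u (γ t)) (u (γ t)) +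
      (K + K₀ * M + C / 2 * M ^ 2) * (s - t) := by
  rcases hts.eq_or_lt with rfl | hts'
  · simp
  have hmin : ∀ t ∈ Icc 0 T, IsMinimalSupergradient H u (γ t) (pSharp H u (γ t)) := fun t ht =>
    h.semiconcaveLipschitzOn.isMinimalSupergradient_pSharp hH.continuous hconv hu hΩ (h.mem_ball ht)
  have hs' : s ∈ Icc 0 T := ⟨ht.trans hts, hs⟩
  exact ((hmin s hs').2 _ (h.mem_superdiff hs')).trans (h.energy_le_add hH
    (fun x w => (hconv x w).convexOn) ht hts' hs (hmin t ⟨ht, hts.trans hs⟩).1)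

theorem tendsto_curve (h : IsLimitCharacteristic H u c r C L M K₀ K T ε τ z y p γ P)
    (ht : t ∈ Ico 0 T) : Tendsto γ (𝓝[>] t) (𝓝 (γ t)) := by
  have h1 := h.lipschitzOnWith.continuousOn t ⟨ht.1, ht.2.le⟩
  refine h1.mono_left ?_
  rw [← nhdsWithin_Ioo_eq_nhdsGT ht.2]
  exact nhdsWithin_mono _ fun s hs => ⟨ht.1.trans hs.1.le, hs.2.le⟩

/-- The minimal supergradient is right-continuous along the limit curve. -/
theorem tendsto_pSharp
    (hH : ContDiff ℝ 1 fun z : Euc n × Euc n × ℝ => H z.1 z.2.1 z.2.2)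
    (hconv : ∀ x w, StrictConvexOn ℝ univ fun p => H x p w)
    (hu : IsSemiconcaveSolution H Ω u) (hΩ : Metric.ball c r ⊆ Ω)
    (h : IsLimitCharacteristic H u c r C L M K₀ K T ε τ z y p γ P) (ht : t ∈ Ico 0 T) :
    Tendsto (fun s => pSharp H u (γ s)) (𝓝[>] t) (𝓝 (pSharp H u (γ t))) := by
  rw [Metric.tendsto_nhds]
  intro η hη
  obtain ⟨δ, hδ, h1⟩ := h.semiconcaveLipschitzOn.exists_forall_dist_pSharp_lt hH.continuous hconv hu
    hΩ (h.mem_ball ⟨ht.1, ht.2.le⟩) hη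
  have h2 := (h.tendsto_curve ht).eventually (Metric.ball_mem_nhds _ hδ)
  have h3 : Tendsto (fun s => (K + K₀ * M + C / 2 * M ^ 2) * (s - t)) (𝓝[>] t) (𝓝 0) := by
    refine Tendsto.mono_left ?_ nhdsWithin_le_nhds
    have : Continuous fun s => (K + K₀ * M + C / 2 * M ^ 2) * (s - t) := by fun_prop
    simpa using this.tendsto t
  filter_upwards [h2, h3.eventually (gt_mem_nhds hδ), Ioo_mem_nhdsGT ht.2] with s hs1 hs2 hs3
  have hs : s ∈ Icc 0 T := ⟨ht.1.trans hs3.1.le, hs3.2.le⟩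
  have h4 := h.minimal_energy_le_add hH hconv hu hΩ ht.1 hs3.1.le hs3.2.le
  rw [dist_eq_norm]
  refine h1 _ _ (by rwa [← dist_eq_norm])
    (h.semiconcaveLipschitzOn.isMinimalSupergradient_pSharp hH.continuous hconv hu hΩ
      (h.mem_ball hs)).1 (by linarith)

theorem tendsto_vSharp
    (hH : ContDiff ℝ 1 fun z : Euc n × Euc n × ℝ => H z.1 z.2.1 z.2.2)
    (hconv : ∀ x w, StrictConvexOn ℝ univ fun p => H x p w)
    (hu : IsSemiconcaveSolution H Ω u) (hΩ : Metric.ball c r ⊆ Ω)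
    (h : IsLimitCharacteristic H u c r C L M K₀ K T ε τ z y p γ P) (ht : t ∈ Ico 0 T) :
    Tendsto (fun s => vSharp H u (γ s)) (𝓝[>] t) (𝓝 (vSharp H u (γ t))) := by
  have h1 := h.tendsto_curve ht
  have h2 : Tendsto (fun s => u (γ s)) (𝓝[>] t) (𝓝 (u (γ t))) :=
    Tendsto.comp (h.semiconcaveLipschitzOn.continuousAt (h.mem_ball ⟨ht.1, ht.2.le⟩)) h1
  have h3 := h1.prodMk_nhds ((h.tendsto_pSharp hH hconv hu hΩ ht).prodMk_nhds h2)
  have h4 := ((continuous_gradP hH).tendsto (γ t, pSharp H u (γ t), u (γ t))).comp h3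
  exact h4

theorem norm_displacement_sub_le
    (h : IsLimitCharacteristic H u c r C L M K₀ K T ε τ z y p γ P) {v : Euc n} {η : ℝ}
    (ht : 0 ≤ t) (hts : t ≤ s) (hs : s ≤ T)
    (hv : ∀ᶠ k in hyperfilter ℕ, ∀ i, ⌊t / τ k⌋₊ ≤ i → i < ⌊s / τ k⌋₊ →
      ‖gradP H (y k i) (p k i) (u (y k i)) - v‖ ≤ η) :
    ‖γ s - γ t - (s - t) • v‖ ≤ (s - t) * η := by
  have hs' : s ∈ Icc 0 T := ⟨ht.trans hts, hs⟩
  have hd := h.tendsto_time_sub ht hs'.1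
  refine le_of_tendsto_of_tendsto (((h.tendsto_z s hs').sub (h.tendsto_z t
    ⟨ht, hts.trans hs⟩)).sub (hd.smul_const v)).norm (hd.mul_const η) ?_
  filter_upwards [hv] with k hk
  exact (h.discrete k).norm_displacement_sub_le (h.index_mono hts k) (h.index_mul_le hs' k) hk

/-- Just after time `t`, discrete velocities are uniformly close to `v^#(γ(t))`, because the
corresponding points are close to `γ(t)` and the energies nearly minimal there. Averaging these
velocities gives the difference quotient. -/
theorem hasDerivWithinAt
    (hH : ContDiff ℝ 1 fun z : Euc n × Euc n × ℝ => H z.1 z.2.1 z.2.2)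
    (hconv : ∀ x w, StrictConvexOn ℝ univ fun p => H x p w)
    (hu : IsSemiconcaveSolution H Ω u) (hΩ : Metric.ball c r ⊆ Ω)
    (h : IsLimitCharacteristic H u c r C L M K₀ K T ε τ z y p γ P) (ht : t ∈ Ico 0 T) :
    HasDerivWithinAt γ (vSharp H u (γ t)) (Ioi t) t := by
  have ht' : t ∈ Icc 0 T := ⟨ht.1, ht.2.le⟩
  set v := vSharp H u (γ t) with hv
  have hM := h.bounds.M_pos
  have hK := h.K_nonneg
  set D := K + K₀ * M + C / 2 * M ^ 2 with hD
  rw [hasDerivWithinAt_iff_isLittleO, Asymptotics.isLittleO_iff]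
  intro η hη
  obtain ⟨δ, hδ, hclose⟩ := h.semiconcaveLipschitzOn.exists_forall_norm_gradP_sub_vSharp_le hH
    hconv hu hΩ (h.mem_ball ht') hη
  have hsmall : ∀ᶠ s in 𝓝[>] t, D * (s - t) < δ / 2 ∧ K * (s - t) < δ / 2 ∧
      M * (s - t) < δ := by
    have key : ∀ a b : ℝ, 0 < b → ∀ᶠ s in 𝓝[>] t, a * (s - t) < b := fun a b hb => by
      have h1 : Continuous fun s => a * (s - t) := by fun_prop
      have h2 := h1.tendsto t
      rw [sub_self, mul_zero] at h2
      exact (h2.mono_left nhdsWithin_le_nhds).eventually (gt_mem_nhds hb)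
    exact (key _ _ (half_pos hδ)).and ((key _ _ (half_pos hδ)).and (key _ _ hδ))
  filter_upwards [hsmall, Ioo_mem_nhdsGT ht.2] with s hs1 hs2
  obtain ⟨hsD, hsK, hsM⟩ := hs1
  have hs' : s ∈ Icc 0 T := ⟨ht.1.trans hs2.1.le, hs2.2.le⟩
  have hD0 : 0 ≤ D := by
    have := h.bounds.K_nonneg
    have := h.semiconcaveLipschitzOn.C_pos
    positivity
  -- The energy comparison holds only at times strictly after `t`, since `P t` itself need not be
  -- minimal. One therefore starts at `t' > t` and lets `t'` decrease to `t` at the end. One `δ / 2`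
  -- covers the energy at `t'`, the other its drift over the steps from `t'` to `s`.
  have hmain : ∀ t' ∈ Ioo t s, ‖γ s - γ t' - (s - t') • v‖ ≤ (s - t') * η := by
    intro t' htt
    have ht0 : 0 ≤ t' := ht.1.trans htt.1.le
    have htT : t' ∈ Icc 0 T := ⟨ht0, htt.2.le.trans hs'.2⟩
    refine h.norm_displacement_sub_le ht0 htt.2.le hs'.2 ?_
    have hd := h.tendsto_time_sub ht0 hs'.1
    have h1 := h.energy_le_add hH (fun x w => (hconv x w).convexOn) ht.1 htt.1 htT.2
      (h.semiconcaveLipschitzOn.isMinimalSupergradient_pSharp hH.continuous hconv hu hΩ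
        (h.mem_ball ht')).1
    rw [← hD] at h1
    have h2 := h.norm_sub_le ht.1 htt.1.le htT.2
    have h3 : D * (t' - t) ≤ D * (s - t) := by gcongr; exact htt.2.le
    have h4 : K * (s - t') ≤ K * (s - t) := by gcongr; exact htt.1.le
    have h5 := ((h.tendsto_energy hH.continuous htT).add (hd.const_mul K)).eventually_lt_const
      (u := H (γ t) (pSharp H u (γ t)) (u (γ t)) + δ) (by linarith)
    have h6 := (((hd.const_mul M).add ((h.tendsto_z t' htT).sub_const (γ t)).norm).add
      (h.tendsto_ε.mul_const L)).eventually_lt_const (u := δ) (by linarith)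
    filter_upwards [h5, h6] with k hk5 hk6 i hji him
    have hi := (h.discrete k).time_le him.le (h.index_mul_le hs' k)
    have hτ := (h.discrete k).τ_pos
    have h7 : (i : ℝ) ≤ ⌊s / τ k⌋₊ := by exact_mod_cast him.le
    have h8 := (h.discrete k).norm_sub_le h.semiconcaveLipschitzOn hji hi (γ t)
    have h9 := (h.discrete k).energy_le_of_le hji hi
    have h10 : (i - (⌊t' / τ k⌋₊ : ℝ)) * τ k ≤ (⌊s / τ k⌋₊ - (⌊t' / τ k⌋₊ : ℝ)) * τ k := by gcongr
    refine hclose _ _ ?_ ((h.discrete k).mem_superdiff i hi) ?_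
    · have : M * ((i - (⌊t' / τ k⌋₊ : ℝ)) * τ k) ≤
        M * ((⌊s / τ k⌋₊ - (⌊t' / τ k⌋₊ : ℝ)) * τ k) := by gcongr
      linarith
    · have : K * ((i - (⌊t' / τ k⌋₊ : ℝ)) * τ k) ≤
        K * ((⌊s / τ k⌋₊ - (⌊t' / τ k⌋₊ : ℝ)) * τ k) := by gcongr
      linarith
  have hid : Tendsto (fun t' : ℝ => s - t') (𝓝[>] t) (𝓝 (s - t)) :=
    tendsto_const_nhds.sub (tendsto_id.mono_left nhdsWithin_le_nhds)
  have h1 := le_of_tendsto_of_tendsto (((h.tendsto_curve ht).const_sub (γ s)).sub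
    (hid.smul_const v)).norm (hid.mul_const η)
    (Filter.mem_of_superset (Ioo_mem_nhdsGT hs2.1) hmain)
  rw [Real.norm_of_nonneg (sub_nonneg.2 hs2.1.le), mul_comm]
  exact h1

end IsLimitCharacteristic

/-! ### Measurability and almost everywhere differentiability from right limits. -/

/-- A right-continuous function on `ℝ` is measurable. -/
theorem measurable_of_tendsto_nhdsGT {f : ℝ → Euc n}
    (hf : ∀ t, Tendsto f (𝓝[>] t) (𝓝 (f t))) : Measurable f := by
  -- `f` is sampled at the first grid point strictly to the right of `t`; the `+ 1` ensures
  -- strictness, as `f` is controlled only on that side.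
  let g : ℕ → ℝ → Euc n := fun k t => f ((⌊t * (k + 1)⌋ + 1 : ℝ) / (k + 1))
  have hg : ∀ k, Measurable (g k) := fun k => by
    have h1 : Measurable fun i : ℤ => f ((i + 1 : ℝ) / (k + 1)) := measurable_from_top
    exact h1.comp (Int.measurable_floor.comp (measurable_id.mul_const _))
  refine measurable_of_tendsto_metrizable hg (tendsto_pi_nhds.2 fun t => ?_)
  refine (hf t).comp (tendsto_nhdsWithin_iff.2 ⟨?_, Eventually.of_forall fun k => ?_⟩)
  · have h1 : Tendsto (fun k : ℕ => t + 1 / (k + 1 : ℝ)) atTop (𝓝 (t + 0)) :=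
      tendsto_one_div_add_atTop_nhds_zero_nat.const_add t
    rw [add_zero] at h1
    refine tendsto_of_tendsto_of_tendsto_of_le_of_le tendsto_const_nhds h1 (fun k => ?_)
      fun k => ?_
    · have hk : (0 : ℝ) < k + 1 := by positivity
      simp only
      rw [le_div_iff₀ hk]
      exact (Int.lt_floor_add_one _).le
    · have hk : (0 : ℝ) < k + 1 := by positivity
      simp only
      rw [div_le_iff₀ hk, add_mul, one_div_mul_cancel hk.ne']
      linarith [Int.floor_le (t * (k + 1))]
  · have hk : (0 : ℝ) < k + 1 := by positivity
    rw [mem_Ioi, lt_div_iff₀ hk]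
    exact Int.lt_floor_add_one _

/-- Extension by zero off the half-open interval `[a, b')` preserves right continuity everywhere;
the margin `b < b'` covers the closed endpoint `b`. -/
theorem exists_measurable_eqOn {f : ℝ → Euc n} {a b b' : ℝ} (hb : b < b')
    (hf : ∀ t ∈ Ico a b', Tendsto f (𝓝[>] t) (𝓝 (f t))) :
    ∃ g : ℝ → Euc n, Measurable g ∧ EqOn g f (Icc a b) := by
  classical
  refine ⟨(Ico a b').indicator f, measurable_of_tendsto_nhdsGT fun t => ?_, fun t ht =>
    indicator_of_mem (mem_Ico.2 ⟨ht.1, ht.2.trans_lt hb⟩) f⟩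
  by_cases ht : t ∈ Ico a b'
  · rw [indicator_of_mem ht]
    refine (hf t ht).congr' ?_
    filter_upwards [Ioo_mem_nhdsGT ht.2] with s hs
    exact (indicator_of_mem (mem_Ico.2 ⟨ht.1.trans hs.1.le, hs.2⟩) f).symm
  · rw [indicator_of_notMem ht]
    refine tendsto_const_nhds.congr' ?_
    rw [mem_Ico, not_and_or, not_le, not_lt] at ht
    rcases ht with ht | ht
    · filter_upwards [Ioo_mem_nhdsGT ht] with s hs
      exact (indicator_of_notMem (fun h => hs.2.not_ge h.1) f).symm
    · filter_upwards [self_mem_nhdsWithin] with s hs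
      exact (indicator_of_notMem (fun h => (ht.trans_lt hs).not_ge h.2.le) f).symm

/-- By Rademacher's theorem a two-sided derivative exists almost everywhere, and it must agree with
the right derivative. -/
theorem _root_.LipschitzOnWith.ae_hasDerivAt_of_rightDeriv {f f' : ℝ → Euc n} {K : NNReal} {a b : ℝ}
    (hf : LipschitzOnWith K f (Icc a b))
    (hf' : ∀ t ∈ Ico a b, HasDerivWithinAt f (f' t) (Ioi t) t) :
    ∀ᵐ t ∂(volume.restrict (Icc a b)), HasDerivAt f (f' t) t := by
  rw [← restrict_Ioo_eq_restrict_Icc]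
  have h1 := (hf.mono Ioo_subset_Icc_self).ae_differentiableWithinAt_real measurableSet_Ioo
  filter_upwards [h1, ae_restrict_mem measurableSet_Ioo] with t ht1 ht2
  have h2 := (ht1.differentiableAt (Ioo_mem_nhds ht2.1 ht2.2)).hasDerivAt
  have h3 := (uniqueDiffWithinAt_Ioi t).eq_deriv _ h2.hasDerivWithinAt
    (hf' t ⟨ht2.1.le, ht2.2⟩)
  rwa [h3] at h2

end HJ

/-! ### The main theorem. -/

theorem theorem1p1
    (H : EuclideanSpace ℝ (Fin 2) → EuclideanSpace ℝ (Fin 2) → ℝ → ℝ)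
    (hH : ContDiff ℝ 1
      (fun z : EuclideanSpace ℝ (Fin 2) × EuclideanSpace ℝ (Fin 2) × ℝ => H z.1 z.2.1 z.2.2))
    (hconv : ∀ (x : EuclideanSpace ℝ (Fin 2)) (w : ℝ),
      StrictConvexOn ℝ Set.univ (fun p => H x p w))
    (Ω : Set (EuclideanSpace ℝ (Fin 2))) (hΩ_open : IsOpen Ω) (hΩ_conn : IsConnected Ω)
    (u : EuclideanSpace ℝ (Fin 2) → ℝ) (hu : HJ.IsSemiconcaveSolution H Ω u) :
    (∀ x ∈ Ω, ∃! p, HJ.IsMinimalSupergradient H u x p) ∧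
    ∀ x₀ ∈ HJ.singularSet Ω u,
      ∃ (t₀ : ℝ) (γ : ℝ → EuclideanSpace ℝ (Fin 2)), 0 < t₀ ∧
        (∃ K : NNReal, LipschitzOnWith K γ (Set.Icc 0 t₀)) ∧
        γ 0 = x₀ ∧
        (∀ t ∈ Set.Ico 0 t₀, HasDerivWithinAt γ (HJ.vSharp H u (γ t)) (Set.Ioi t) t) ∧
        (∀ t ∈ Set.Ico 0 t₀,
          Tendsto (fun s => HJ.vSharp H u (γ s)) (𝓝[>] t) (𝓝 (HJ.vSharp H u (γ t)))) ∧
        (∀ t ∈ Set.Icc 0 t₀, γ t ∈ HJ.singularSet Ω u) ∧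
        HJ.IsStrictSingularCharacteristic H Ω u x₀ t₀ γ := by
  have hbase : ∀ x ∈ Ω, ∃ r C L, Metric.ball x r ⊆ Ω ∧ HJ.SemiconcaveLipschitzOn u x r C L :=
    fun x hx => hu.semiconcave.exists_semiconcaveLipschitzOn hx
  refine ⟨fun x hx => ?_, fun x₀ hx₀ => ?_⟩
  · obtain ⟨r, C, L, hΩ, h⟩ := hbase x hx
    exact h.existsUnique_isMinimalSupergradient hH.continuous hconv hu hΩ
      (Metric.mem_ball_self h.r_pos)
  obtain ⟨r, C, L, hΩ, hs⟩ := hbase x₀ hx₀.1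
  obtain ⟨M, K₀, K, T, ε, τ, z, y, p, γ, P, hT, h⟩ :=
    hs.exists_isLimitCharacteristic hH fun x w => (hconv x w).convexOn
  have hγ0 : γ 0 = x₀ := h.zero hT.le
  have hneg : H x₀ (HJ.pSharp H u x₀) (u x₀) < 0 :=
    (hs.mem_singularSet_iff hH.continuous hconv hu hΩ (Metric.mem_ball_self hs.r_pos)).1 hx₀
  -- Up to `t₀` the linear bound keeps the minimal energy negative. The strict inequality `t₀ < T`
  -- leaves room for right continuity at `t₀`, needed for the measurable selection on the closed
  -- interval.
  obtain ⟨t₀, ⟨ht₀, htT⟩, htneg⟩ : ∃ t₀ ∈ Set.Ioo 0 T, H x₀ (HJ.pSharp H u x₀) (u x₀) +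
      (K + K₀ * M + C / 2 * M ^ 2) * t₀ < 0 := by
    have h1 : Continuous fun t => H x₀ (HJ.pSharp H u x₀) (u x₀) +
      (K + K₀ * M + C / 2 * M ^ 2) * t := by fun_prop
    have h2 := (h1.tendsto 0).eventually_lt_const (u := 0) (by simpa using hneg)
    exact ((Filter.Eventually.filter_mono nhdsWithin_le_nhds h2).and
      (Ioo_mem_nhdsGT hT)).exists.imp fun t ht => ⟨ht.2, ht.1⟩
  have hsub : Set.Icc 0 t₀ ⊆ Set.Icc 0 T := Set.Icc_subset_Icc_right htT.le
  have hIco : Set.Ico 0 t₀ ⊆ Set.Ico 0 T := Set.Ico_subset_Ico_right htT.le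
  have hlip := h.lipschitzOnWith.mono hsub
  have hder : ∀ t ∈ Set.Ico 0 t₀, HasDerivWithinAt γ (HJ.vSharp H u (γ t)) (Set.Ioi t) t :=
    fun t ht => h.hasDerivWithinAt hH hconv hu hΩ (hIco ht)
  have hsing : ∀ t ∈ Set.Icc 0 t₀, γ t ∈ HJ.singularSet Ω u := by
    intro t ht
    refine (hs.mem_singularSet_iff hH.continuous hconv hu hΩ (h.mem_ball (hsub ht))).2 ?_
    have h1 := h.minimal_energy_le_add hH hconv hu hΩ le_rfl ht.1 (hsub ht).2
    rw [hγ0, sub_zero] at h1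
    have h2 : (K + K₀ * M + C / 2 * M ^ 2) * t ≤ (K + K₀ * M + C / 2 * M ^ 2) * t₀ := by
      have := h.bounds.K_nonneg
      have := h.bounds.M_pos
      have := h.K_nonneg
      have := hs.C_pos
      gcongr
      exact ht.2
    linarith
  obtain ⟨g, hg, hgeq⟩ := HJ.exists_measurable_eqOn htT fun t ht =>
    h.tendsto_pSharp hH hconv hu hΩ ht
  refine ⟨t₀, γ, ht₀, ⟨_, hlip⟩, hγ0, hder, fun t ht => h.tendsto_vSharp hH hconv hu hΩ (hIco ht),
    hsing, ⟨_, hlip⟩, hγ0, hsing, g, hg, fun t ht => ?_, ?_⟩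
  · rw [hgeq ht]
    exact (hs.isMinimalSupergradient_pSharp hH.continuous hconv hu hΩ (h.mem_ball (hsub ht))).1
  · filter_upwards [hlip.ae_hasDerivAt_of_rightDeriv hder, ae_restrict_mem measurableSet_Icc]
      with t ht1 ht2
    rw [hgeq ht2]
    exact ht1
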